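/- Consider the symmetric two-user Gaussian interference channel with feedback, with direct gain $g_d\in\mathbb{C}$ and cross gain $g_c\in\mathbb{C}$. At each time $i$ the receivers observe $$Y_{1i}=g_dX_{1i}+g_cX_{2i}+Z_{1i},\qquad Y_{2i}=g_cX_{1i}+g_dX_{2i}+Z_{2i},$$ where all the noise variables $Z_{ki}$ are independent and circularly symmetric complex Gaussian, $Z_{ki}\sim\mathcal{CN}(0,1)$. The messages $W_1,W_2$ are independent, uniformly distributed on $\{1,\dots,M_1\}$ and $\{1,\dots,M_2\}$, and independent of the noise. In a code of block length $N$, the encoders are (measurable) functions $X_{ki}=f_k^i(W_k,Y_{k1},\dots,Y_{k(i-1)})$, $1\le i\le N$, subject to the unit power constraint $\frac1N\sum_{i=1}^N E|X_{ki}|^2\le 1$ for $k=1,2$, and receiver $k$ forms an estimate $\hat W_k$ of $W_k$ from $(Y_{k1},\dots,Y_{kN})$. A pair $(R_1,R_2)$ of nonnegative rates (in bits per channel use) is achievable if there are such codes for every block length $N$, with $M_k\ge 2^{NR_k}$ and with $P(\hat W_k\ne W_k)\to0$ as $N\to\infty$, for $k=1,2$. The capacity region $\mathcal R$ is the closure of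 the set of achievable pairs, and the feedback symmetric capacity is $C_{\mathsf{sym}}=\sup\{R:(R,R)\in\mathcal R\}$. Put $\mathsf{SNR}=|g_d|^2$ and $\mathsf{INR}=|g_c|^2$. **Theorem.** For all $g_d,g_c\in\mathbb{C}$, $$C_{\mathsf{sym}}\le\frac12\sup_{0\le\rho\le1}\left[\log_2\left(1+\frac{(1-\rho^2)\,\mathsf{SNR}}{1+(1-\rho^2)\,\mathsf{INR}}\right)+\log_2\left(1+\mathsf{SNR}+\mathsf{INR}+2\rho\sqrt{\mathsf{SNR}\cdot\mathsf{INR}}\right)\right].$$ -/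

import Mathlib

open MeasureTheory ProbabilityTheory Filter Topology

noncomputable section

namespace GaussianIC

/-- The circularly symmetric complex Gaussian law `CN(0,1)`: real and imaginary parts are
independent real Gaussians of mean `0` and variance `1/2`. -/
def stdComplexGaussian : Measure ℂ :=
  ((gaussianReal 0 (1 / 2)).prod (gaussianReal 0 (1 / 2))).map
    (fun p : ℝ × ℝ => (⟨p.1, p.2⟩ : ℂ))

/-- The law of `N` independent `CN(0,1)` noise samples. -/
def noiseLaw (N : ℕ) : Measure (Fin N → ℂ) :=
  Measure.pi (fun _ => stdComplexGaussian)

/-- A block code of length `N` with `M₁`, `M₂` messages for the two-user interference channel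
with output feedback. The symbol sent by user `k` at time `i` is a function of its message and of
the `i` channel outputs that its receiver saw strictly before time `i` (times are
`0, …, N - 1`); receiver `k` decodes from its whole output block. -/
structure FeedbackCode (N M₁ M₂ : ℕ) where
  enc₁ : (i : Fin N) → Fin M₁ → (Fin i → ℂ) → ℂ
  enc₂ : (i : Fin N) → Fin M₂ → (Fin i → ℂ) → ℂ
  dec₁ : (Fin N → ℂ) → Fin M₁
  dec₂ : (Fin N → ℂ) → Fin M₂
  measurable_enc₁ : ∀ i w, Measurable (enc₁ i w)
  measurable_enc₂ : ∀ i w, Measurable (enc₂ i w)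
  measurable_dec₁ : Measurable dec₁
  measurable_dec₂ : Measurable dec₂

/-- Sample space: the two messages and the two noise blocks. -/
abbrev Sample (N M₁ M₂ : ℕ) : Type :=
  (Fin M₁ × Fin M₂) × ((Fin N → ℂ) × (Fin N → ℂ))

/-- Independent uniform messages, independent of the two independent i.i.d. `CN(0,1)` noise
blocks. -/
def sampleLaw (N M₁ M₂ : ℕ) : Measure (Sample N M₁ M₂) :=
  ((uniformOn (Set.univ : Set (Fin M₁))).prod (uniformOn (Set.univ : Set (Fin M₂)))).prod
    ((noiseLaw N).prod (noiseLaw N))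

namespace FeedbackCode

variable {N M₁ M₂ : ℕ}

/-- The pair of channel outputs `(Y₁ᵢ, Y₂ᵢ)`, with direct gain `gd` and cross gain `gc`:
`Y₁ᵢ = gd X₁ᵢ + gc X₂ᵢ + Z₁ᵢ` and `Y₂ᵢ = gc X₁ᵢ + gd X₂ᵢ + Z₂ᵢ`, where the inputs `X₁ᵢ`, `X₂ᵢ`
are produced by the encoders from the messages and the past outputs. -/
def output (C : FeedbackCode N M₁ M₂) (gd gc : ℂ) (ω : Sample N M₁ M₂) (i : Fin N) : ℂ × ℂ :=
  let past : Fin i → ℂ × ℂ := fun j => output C gd gc ω ⟨j, j.2.trans i.2⟩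
  let x₁ := C.enc₁ i ω.1.1 (fun j => (past j).1)
  let x₂ := C.enc₂ i ω.1.2 (fun j => (past j).2)
  (gd * x₁ + gc * x₂ + ω.2.1 i, gc * x₁ + gd * x₂ + ω.2.2 i)
termination_by i.val
decreasing_by exact j.2

/-- The output block `Y₁ᴺ`. -/
def Y₁ (C : FeedbackCode N M₁ M₂) (gd gc : ℂ) (ω : Sample N M₁ M₂) (i : Fin N) : ℂ :=
  (C.output gd gc ω i).1

/-- The output block `Y₂ᴺ`. -/
def Y₂ (C : FeedbackCode N M₁ M₂) (gd gc : ℂ) (ω : Sample N M₁ M₂) (i : Fin N) : ℂ :=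
  (C.output gd gc ω i).2

/-- The input `X₁ᵢ = f₁ᵢ(W₁, Y₁^{i-1})`. -/
def X₁ (C : FeedbackCode N M₁ M₂) (gd gc : ℂ) (ω : Sample N M₁ M₂) (i : Fin N) : ℂ :=
  C.enc₁ i ω.1.1 (fun j => C.Y₁ gd gc ω ⟨j, j.2.trans i.2⟩)

/-- The input `X₂ᵢ = f₂ᵢ(W₂, Y₂^{i-1})`. -/
def X₂ (C : FeedbackCode N M₁ M₂) (gd gc : ℂ) (ω : Sample N M₁ M₂) (i : Fin N) : ℂ :=
  C.enc₂ i ω.1.2 (fun j => C.Y₂ gd gc ω ⟨j, j.2.trans i.2⟩)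

/-- The outputs satisfy the equation of the channel at receiver 1. -/
theorem Y₁_eq (C : FeedbackCode N M₁ M₂) (gd gc : ℂ) (ω : Sample N M₁ M₂) (i : Fin N) :
    C.Y₁ gd gc ω i = gd * C.X₁ gd gc ω i + gc * C.X₂ gd gc ω i + ω.2.1 i := by
  unfold Y₁
  rw [output]
  rfl

/-- The outputs satisfy the equation of the channel at receiver 2. -/
theorem Y₂_eq (C : FeedbackCode N M₁ M₂) (gd gc : ℂ) (ω : Sample N M₁ M₂) (i : Fin N) :
    C.Y₂ gd gc ω i = gc * C.X₁ gd gc ω i + gd * C.X₂ gd gc ω i + ω.2.2 i := by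
  unfold Y₂
  rw [output]
  rfl

/-- Unit average power for each user: `∑ᵢ E|Xₖᵢ|² ≤ N`, the expectation being over the messages
and the noise. -/
def PowerConstraint (C : FeedbackCode N M₁ M₂) (gd gc : ℂ) : Prop :=
  (∑ i, ∫⁻ ω, ‖C.X₁ gd gc ω i‖ₑ ^ 2 ∂(sampleLaw N M₁ M₂) ≤ (N : ENNReal)) ∧
  (∑ i, ∫⁻ ω, ‖C.X₂ gd gc ω i‖ₑ ^ 2 ∂(sampleLaw N M₁ M₂) ≤ (N : ENNReal))

/-- The error probability `P(Ŵ₁ ≠ W₁)`. -/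
def error₁ (C : FeedbackCode N M₁ M₂) (gd gc : ℂ) : ENNReal :=
  sampleLaw N M₁ M₂ {ω | C.dec₁ (C.Y₁ gd gc ω) ≠ ω.1.1}

/-- The error probability `P(Ŵ₂ ≠ W₂)`. -/
def error₂ (C : FeedbackCode N M₁ M₂) (gd gc : ℂ) : ENNReal :=
  sampleLaw N M₁ M₂ {ω | C.dec₂ (C.Y₂ gd gc ω) ≠ ω.1.2}

end FeedbackCode

/-- `(R₁, R₂)` (in bits per channel use) is achievable: there are codes of every block length `N`,
meeting the power constraint, with at least `2^(N R₁)` and `2^(N R₂)` messages, whose error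
probabilities tend to `0` as `N → ∞`. -/
def Achievable (gd gc : ℂ) (R₁ R₂ : ℝ) : Prop :=
  0 ≤ R₁ ∧ 0 ≤ R₂ ∧
  ∃ (M₁ M₂ : ℕ → ℕ) (C : (N : ℕ) → FeedbackCode N (M₁ N) (M₂ N)),
    (∀ N : ℕ, (2 : ℝ) ^ ((N : ℝ) * R₁) ≤ (M₁ N : ℝ)) ∧
    (∀ N : ℕ, (2 : ℝ) ^ ((N : ℝ) * R₂) ≤ (M₂ N : ℝ)) ∧
    (∀ N : ℕ, (C N).PowerConstraint gd gc) ∧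
    Tendsto (fun N => (C N).error₁ gd gc) atTop (𝓝 0) ∧
    Tendsto (fun N => (C N).error₂ gd gc) atTop (𝓝 0)

/-- The feedback capacity region: the closure of the set of achievable rate pairs. -/
def capacityRegion (gd gc : ℂ) : Set (ℝ × ℝ) :=
  closure {R | Achievable gd gc R.1 R.2}

/-- The feedback symmetric capacity `sup {R : (R, R) ∈ region}`, a supremum of extended reals. -/
def symmetricCapacity (gd gc : ℂ) : EReal :=
  ⨆ (R : ℝ) (_ : (R, R) ∈ capacityRegion gd gc), (R : EReal)

/-- The signal-to-noise ratio `|gd|²`. -/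
def SNR (gd : ℂ) : ℝ := ‖gd‖ ^ 2

/-- The interference-to-noise ratio `|gc|²`. -/
def INR (gc : ℂ) : ℝ := ‖gc‖ ^ 2

end GaussianIC

end

/-! The sum rate of every achievable pair is bounded by a change of measure, which replaces the
usual entropy computation. For fixed messages the map from noise to outputs is a triangular shift,
so it preserves Lebesgue measure (`measurePreserving_outputs`) and the outputs have as density the
noise density at the recovered noise.

Compare this with a reference law under which `Y₁` is i.i.d. of variance `vB` whatever the messages
are, and `Y₂`, given `W₁` and `Y₁`, is Gaussian of variance `vA` around a linear prediction. The
pair `W₁, Y₁` determines `X₁`, so such a prediction is available: it plays the role of a genie who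
gives `W₁, Y₁` to receiver 2. The reference density does not depend on `W₂`, and its `Y₁`-marginal
does not depend on `W₁`; hence the decoding regions have total reference mass one
(`sum_lintegral_refPDF`). Correct decoding with likelihood ratio at most `K` therefore has
probability at most `K / (M₁ M₂)` (`sampleLaw_correct_le`).

The log-ratio is `N log (vA vB)` plus a difference of energies. If `κ` is the average correlation of
the inputs and `ρ = ‖κ‖`, the minimum mean square predictor gives the normalized output energy a
mean of at most `2N` (`exists_lintegral_refEnergy_le`), while the two noise energies concentrate at
`N` each. Markov's inequality leaves an exceptional probability bounded by a constant below one;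
this suffices, because the error probabilities tend to zero. So `R₁ + R₂` is at most the supremum
over `ρ`, a closed condition that passes to the capacity region, and the diagonal gives the factor
`1/2`. -/

namespace GaussianIC

/-! ### Product measures, product densities and triangular shears. -/

/-- Tonelli's theorem for a product of functions of the separate coordinates. -/
theorem lintegral_pi_prod {G : Type*} [MeasurableSpace G] {n : ℕ} (μ : Fin n → Measure G)
    [∀ i, SigmaFinite (μ i)] (f : Fin n → G → ENNReal) (hf : ∀ i, Measurable (f i)) :
    ∫⁻ x, ∏ i, f i (x i) ∂(Measure.pi μ) = ∏ i, ∫⁻ x, f i x ∂(μ i) := by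
  induction n with
  | zero => simp
  | succ n ih =>
    have h := (measurePreserving_piFinSuccAbove μ 0).symm
    have hm : AEMeasurable (fun x : Fin n → G => ∏ i, f i.succ (x i))
        (Measure.pi fun i => μ i.succ) :=
      (Finset.measurable_prod _ fun i _ => (hf _).comp (measurable_pi_apply i)).aemeasurable
    rw [← h.lintegral_comp (by fun_prop), Fin.prod_univ_succ,
      ← ih (fun i => μ i.succ) (fun i => f i.succ) (fun i => hf _),
      ← lintegral_prod_mul (hf 0).aemeasurable hm]
    refine lintegral_congr fun p => ?_
    simp [Fin.prod_univ_succ, MeasurableEquiv.piFinSuccAbove]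

/-- A product of measures with densities has the product density. -/
theorem pi_withDensity {G : Type*} [MeasurableSpace G] {n : ℕ} (μ : Fin n → Measure G)
    [∀ i, SigmaFinite (μ i)] (f : Fin n → G → ENNReal) (hf : ∀ i, Measurable (f i))
    [∀ i, SigmaFinite ((μ i).withDensity (f i))] :
    Measure.pi (fun i => (μ i).withDensity (f i)) =
      (Measure.pi μ).withDensity (fun x => ∏ i, f i (x i)) := by
  refine Measure.pi_eq fun s hs => ?_
  rw [withDensity_apply _ (MeasurableSet.univ_pi hs),
    ← lintegral_indicator (MeasurableSet.univ_pi hs)]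
  have : ∀ x : Fin n → G, (Set.univ.pi s).indicator (fun x => ∏ i, f i (x i)) x =
      ∏ i, (s i).indicator (f i) (x i) := by
    intro x
    by_cases hx : ∀ i, x i ∈ s i
    · rw [Set.indicator_of_mem (by simpa using hx)]
      exact Finset.prod_congr rfl fun i _ => (Set.indicator_of_mem (hx i) _).symm
    · rw [Set.indicator_of_notMem (by simpa using hx)]
      push Not at hx
      obtain ⟨i, hi⟩ := hx
      exact (Finset.prod_eq_zero (Finset.mem_univ i) (Set.indicator_of_notMem hi _)).symm
  simp_rw [this]
  rw [lintegral_pi_prod μ _ fun i => (hf i).indicator (hs i)]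
  exact Finset.prod_congr rfl fun i _ => by
    rw [lintegral_indicator (hs i), withDensity_apply _ (hs i)]

/-- A triangular shear preserves a product of translation-invariant measures. -/
theorem measurePreserving_shear {G : Type*} [MeasurableSpace G] [AddGroup G] [MeasurableAdd₂ G]
    (μ : Measure G) [SigmaFinite μ] [μ.IsAddRightInvariant] (n : ℕ)
    (s : (i : Fin n) → (Fin i → G) → G) (hs : ∀ i, Measurable (s i)) :
    MeasurePreserving (fun (y : Fin n → G) (i : Fin n) =>
        y i + s i (fun j => y ⟨j, j.2.trans i.2⟩))
      (Measure.pi fun _ => μ) (Measure.pi fun _ => μ) := by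
  induction n with
  | zero =>
    convert MeasurePreserving.id (Measure.pi fun _ : Fin 0 => μ)
  | succ n ih =>
    have e := measurePreserving_piFinSuccAbove (fun _ : Fin (n + 1) => μ) (Fin.last n)
    have ih' := ih (fun i => s i.castSucc) (fun i => hs _)
    -- Over fixed earlier coordinates, the last one is merely translated.
    have sk := ih'.skew_product (μc := μ) (μd := μ)
      (g := fun y t => t + s (Fin.last n) y)
      (by have := hs (Fin.last n); fun_prop)
      (ae_of_all _ fun y => (measurePreserving_add_right μ (s (Fin.last n) y)).map_eq)
    -- `piFinSuccAbove` puts the separated coordinate first, whereas the skew product acts on the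
    -- second factor; hence the two swaps.
    have sw := Measure.measurePreserving_swap (μ := μ) (ν := Measure.pi fun _ : Fin n => μ)
    have sw' := Measure.measurePreserving_swap (μ := Measure.pi fun _ : Fin n => μ) (ν := μ)
    convert e.symm.comp (sw'.comp (sk.comp (sw.comp e))) using 1
    ext y i
    refine Fin.lastCases ?_ (fun i => ?_) i
    · simp [MeasurableEquiv.piFinSuccAbove]
      rfl
    · simp [MeasurableEquiv.piFinSuccAbove]
      rfl

/-! ### The complex Gaussian law: density, symmetry and moments. -/

/-- The density of the circularly symmetric complex Gaussian law of variance `v`. -/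
noncomputable def complexGaussianPDF (v : ℝ) (z : ℂ) : ENNReal :=
  ENNReal.ofReal ((Real.pi * v)⁻¹ * Real.exp (-(‖z‖ ^ 2 / v)))

@[fun_prop]
theorem measurable_complexGaussianPDF (v : ℝ) : Measurable (complexGaussianPDF v) := by
  unfold complexGaussianPDF; fun_prop

theorem lintegral_complexGaussianPDF {v : ℝ} (hv : 0 < v) :
    ∫⁻ z, complexGaussianPDF v z = 1 := by
  have h := GaussianFourier.integral_rexp_neg_mul_sq_norm (V := ℂ) (inv_pos.2 hv)
  have hint := (GaussianFourier.integrable_cexp_neg_mul_sq_norm_add (V := ℂ) (b := (v⁻¹ : ℝ))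
    (by simpa using hv) 0 0).re
  have hint' : Integrable (fun z : ℂ => Real.exp (-v⁻¹ * ‖z‖ ^ 2)) := by
    refine hint.congr (ae_of_all _ fun z => ?_)
    simp only [inner_zero_left, Complex.ofReal_zero, mul_zero, add_zero]
    rw [← Complex.ofReal_pow, ← Complex.ofReal_neg, ← Complex.ofReal_mul, ← Complex.ofReal_exp]
    exact Complex.ofReal_re _
  unfold complexGaussianPDF
  rw [← ofReal_integral_eq_lintegral_ofReal]
  · rw [integral_const_mul]
    have : ∀ z : ℂ, -(‖z‖ ^ 2 / v) = -v⁻¹ * ‖z‖ ^ 2 := fun z => by field_simp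
    simp_rw [this]
    rw [h, Complex.finrank_real_complex]
    have := Real.pi_pos
    norm_num
    field_simp
  · refine Integrable.const_mul ?_ _
    convert hint' using 3
    field_simp
  · exact ae_of_all _ fun z => by have := Real.pi_pos; positivity

instance : IsProbabilityMeasure stdComplexGaussian :=
  Measure.isProbabilityMeasure_map (Complex.measurableEquivRealProd.symm.measurable.aemeasurable)

instance (N : ℕ) : IsProbabilityMeasure (noiseLaw N) := by
  unfold noiseLaw; infer_instance

instance (N : ℕ) : SFinite (noiseLaw N) := instSFiniteOfSigmaFinite

instance (N : ℕ) : SFinite ((noiseLaw N).prod (noiseLaw N)) := Measure.prod.instSFinite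

theorem stdComplexGaussian_eq :
    stdComplexGaussian = ((gaussianReal 0 (1 / 2)).prod (gaussianReal 0 (1 / 2))).map
      Complex.measurableEquivRealProd.symm := rfl

theorem stdComplexGaussian_eq_withDensity :
    stdComplexGaussian = volume.withDensity (complexGaussianPDF 1) := by
  rw [stdComplexGaussian_eq, gaussianReal_of_var_ne_zero _ (by norm_num),
    prod_withDensity (measurable_gaussianPDF _ _) (measurable_gaussianPDF _ _)]
  ext s hs
  rw [Measure.map_apply (MeasurableEquiv.measurable _) hs,
    withDensity_apply _ (MeasurableEquiv.measurable _ hs), withDensity_apply _ hs,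
    ← Complex.volume_preserving_equiv_real_prod.symm.setLIntegral_comp_preimage hs (by fun_prop)]
  refine lintegral_congr fun p => ?_
  simp only [gaussianPDF, complexGaussianPDF]
  rw [← ENNReal.ofReal_mul (gaussianPDFReal_nonneg _ _ _)]
  congr 1
  simp only [gaussianPDFReal, ← Complex.normSq_eq_norm_sq, Complex.normSq_apply]
  rw [mul_mul_mul_comm, ← Real.exp_add, ← mul_inv, Real.mul_self_sqrt (by positivity)]
  simp [Complex.measurableEquivRealProd]
  ring_nf

theorem noiseLaw_eq_withDensity (N : ℕ) :
    noiseLaw N = volume.withDensity (fun z => ∏ i, complexGaussianPDF 1 (z i)) := by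
  have h : SigmaFinite ((volume : Measure ℂ).withDensity (complexGaussianPDF 1)) := by
    rw [← stdComplexGaussian_eq_withDensity]; infer_instance
  unfold noiseLaw
  simp_rw [stdComplexGaussian_eq_withDensity]
  exact pi_withDensity (fun _ => volume) _ fun _ => by fun_prop

theorem measurePreserving_neg_stdComplexGaussian :
    MeasurePreserving (fun z : ℂ => -z) stdComplexGaussian stdComplexGaussian := by
  refine ⟨measurable_neg, ?_⟩
  rw [stdComplexGaussian_eq_withDensity]
  ext s hs
  rw [Measure.map_apply measurable_neg hs, withDensity_apply _ (measurable_neg hs),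
    withDensity_apply _ hs, ← (Measure.measurePreserving_neg (volume : Measure ℂ)
      ).setLIntegral_comp_preimage hs (by fun_prop)]
  exact lintegral_congr fun z => by simp [complexGaussianPDF]

theorem lintegral_enorm_sq_stdComplexGaussian :
    ∫⁻ z, ‖z‖ₑ ^ 2 ∂stdComplexGaussian = 1 := by
  have hg : ∫⁻ x, ENNReal.ofReal (x ^ 2) ∂(gaussianReal 0 (1 / 2)) = ENNReal.ofReal (1 / 2) := by
    have hv := variance_fun_id_gaussianReal (μ := 0) (v := 1 / 2)
    rw [variance_of_integral_eq_zero (by fun_prop) integral_id_gaussianReal] at hv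
    rw [← ofReal_integral_eq_lintegral_ofReal, hv]
    · norm_num
    · exact (memLp_id_gaussianReal 2).integrable_sq
    · exact ae_of_all _ fun x => sq_nonneg x
  rw [stdComplexGaussian_eq, lintegral_map (by fun_prop) (MeasurableEquiv.measurable _)]
  have : ∀ p : ℝ × ℝ, ‖Complex.measurableEquivRealProd.symm p‖ₑ ^ 2 =
      ENNReal.ofReal (p.1 ^ 2) + ENNReal.ofReal (p.2 ^ 2) := by
    intro p
    rw [← ENNReal.ofReal_add (sq_nonneg _) (sq_nonneg _), ← ofReal_norm,
      ← ENNReal.ofReal_pow (norm_nonneg _), ← Complex.normSq_eq_norm_sq, Complex.normSq_apply]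
    simp [Complex.measurableEquivRealProd, sq]
  simp_rw [this]
  rw [lintegral_add_left (by fun_prop),
    lintegral_prod _ (by fun_prop), lintegral_prod _ (by fun_prop)]
  simp only [lintegral_const, measure_univ, mul_one, hg]
  rw [← ENNReal.ofReal_add (by norm_num) (by norm_num)]
  norm_num

/-- Finite fourth moments of the noise, needed for Chebyshev's inequality on its energy. -/
theorem memLp_normSq_stdComplexGaussian :
    MemLp (fun z : ℂ => ‖z‖ ^ 2) 2 stdComplexGaussian := by
  have hg : MemLp (fun x : ℝ => x ^ 2) 2 (gaussianReal 0 (1 / 2)) := by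
    have h := (memLp_id_gaussianReal (μ := 0) (v := 1 / 2) 4).norm_rpow_div 2
    have e : ((4 : NNReal) : ENNReal) / 2 = 2 := by
      rw [show ((4 : NNReal) : ENNReal) = 2 * 2 by norm_num]
      exact ENNReal.mul_div_cancel_right (by norm_num) (by norm_num)
    rw [e] at h
    refine h.congr_norm (by fun_prop) (ae_of_all _ fun x => ?_)
    simp
  rw [stdComplexGaussian_eq, memLp_map_measure_iff (by fun_prop) (by fun_prop)]
  have h1 := hg.comp_measurePreserving
    (measurePreserving_fst (μ := gaussianReal 0 (1 / 2)) (ν := gaussianReal 0 (1 / 2)))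
  have h2 := hg.comp_measurePreserving
    (measurePreserving_snd (μ := gaussianReal 0 (1 / 2)) (ν := gaussianReal 0 (1 / 2)))
  convert h1.add h2 using 1
  ext p
  simp only [← Complex.normSq_eq_norm_sq, Complex.normSq_apply, Function.comp_apply]
  simp [Complex.measurableEquivRealProd, sq]

theorem integral_normSq_stdComplexGaussian : ∫ z, ‖z‖ ^ 2 ∂stdComplexGaussian = 1 := by
  rw [integral_eq_lintegral_of_nonneg_ae (ae_of_all _ fun z => by positivity) (by fun_prop)]
  have := lintegral_enorm_sq_stdComplexGaussian
  simp_rw [← ofReal_norm, ← ENNReal.ofReal_pow (norm_nonneg _)] at this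
  rw [this, ENNReal.toReal_one]

/-- The energy of `N` noise samples is rarely much below `N`. -/
theorem noiseLaw_energy_le (N : ℕ) (hN : 0 < N) {ε : ℝ} (hε : 0 < ε) :
    noiseLaw N {z | ∑ i, ‖z i‖ ^ 2 ≤ N * (1 - ε)} ≤
      ENNReal.ofReal (Var[fun z : ℂ => ‖z‖ ^ 2; stdComplexGaussian] / (N * ε ^ 2)) := by
  have hN' : (0 : ℝ) < N := by exact_mod_cast hN
  set X : (Fin N → ℂ) → ℝ := fun z => ∑ i, ‖z i‖ ^ 2
  have hev : ∀ i : Fin N, MeasurePreserving (Function.eval i) (noiseLaw N) stdComplexGaussian :=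
    fun i => measurePreserving_eval _ i
  have hX : MemLp X 2 (noiseLaw N) :=
    memLp_finsetSum _ fun i _ =>
      memLp_normSq_stdComplexGaussian.comp_measurePreserving (hev i)
  have hmean : ∫ z, X z ∂(noiseLaw N) = N := by
    simp only [X]
    have hint : ∀ i : Fin N, Integrable (fun z => ‖z i‖ ^ 2) (noiseLaw N) := fun i =>
      (memLp_normSq_stdComplexGaussian.comp_measurePreserving (hev i)).integrable (by norm_num)
    rw [integral_finsetSum _ fun i _ => hint i]
    have : ∀ i : Fin N, ∫ z, ‖z i‖ ^ 2 ∂(noiseLaw N) = 1 := fun i => by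
      rw [← integral_normSq_stdComplexGaussian, ← (hev i).map_eq,
        integral_map (hev i).aemeasurable (by fun_prop)]
    simp [this]
  have hvar : Var[X; noiseLaw N] = N * Var[fun z : ℂ => ‖z‖ ^ 2; stdComplexGaussian] := by
    have := variance_sum_pi (μ := fun _ : Fin N => stdComplexGaussian)
      (X := fun _ z => ‖z‖ ^ 2) (fun _ => memLp_normSq_stdComplexGaussian)
    rw [Finset.sum_const, Finset.card_univ, Fintype.card_fin, nsmul_eq_mul] at this
    rw [← this]
    congr 1
    ext z
    simp [X]
  have h := meas_ge_le_variance_div_sq hX (c := N * ε) (by positivity)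
  rw [hvar, hmean] at h
  refine (measure_mono fun z hz => ?_).trans (h.trans_eq ?_)
  · simp only [Set.mem_ofPred_eq] at hz ⊢
    rw [abs_sub_comm]
    exact le_trans (by simp only [X]; linarith) (le_abs_self _)
  · congr 1
    field_simp

/-! ### Second moments: orthogonality and correlation. -/

/-- Orthogonality from a symmetry: if a measure preserving map fixes `u` and negates `v`, then
second moments add. -/
theorem lintegral_enorm_add_sq_of_symmetry {Ω : Type*} [MeasurableSpace Ω] {μ : Measure Ω}
    {F : Ω → Ω} (hF : MeasurePreserving F μ μ) {u v : Ω → ℂ} (hu : Measurable u)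
    (hv : Measurable v) (huF : ∀ ω, u (F ω) = u ω) (hvF : ∀ ω, v (F ω) = -v ω) :
    ∫⁻ ω, ‖u ω + v ω‖ₑ ^ 2 ∂μ = ∫⁻ ω, ‖u ω‖ₑ ^ 2 ∂μ + ∫⁻ ω, ‖v ω‖ₑ ^ 2 ∂μ := by
  have h1 : ∫⁻ ω, ‖u ω + v ω‖ₑ ^ 2 ∂μ = ∫⁻ ω, ‖u ω - v ω‖ₑ ^ 2 ∂μ := by
    rw [← hF.lintegral_comp (by fun_prop)]
    simp only [huF, hvF, sub_eq_add_neg]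
  -- The parallelogram law. Working with `lintegral` makes integrability assumptions unnecessary.
  have h2 : ∫⁻ ω, ‖u ω + v ω‖ₑ ^ 2 ∂μ + ∫⁻ ω, ‖u ω - v ω‖ₑ ^ 2 ∂μ =
      2 * (∫⁻ ω, ‖u ω‖ₑ ^ 2 ∂μ + ∫⁻ ω, ‖v ω‖ₑ ^ 2 ∂μ) := by
    rw [← lintegral_add_left (by fun_prop), ← lintegral_add_left (by fun_prop),
      ← lintegral_const_mul _ (by fun_prop)]
    refine lintegral_congr fun ω => ?_
    simp_rw [← ofReal_norm, ← ENNReal.ofReal_pow (norm_nonneg _)]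
    rw [← ENNReal.ofReal_add (by positivity) (by positivity),
      ← ENNReal.ofReal_add (by positivity) (by positivity),
      show (2 : ENNReal) = ENNReal.ofReal 2 by simp, ← ENNReal.ofReal_mul (by norm_num)]
    congr 1
    have := parallelogram_law_with_norm ℝ (u ω) (v ω)
    simp only [sq]
    linarith
  rw [← h1, ← two_mul] at h2
  exact (ENNReal.mul_right_inj (by norm_num) (by norm_num)).1 h2

/-- Two families of square integrable signals of average power at most one have an average
correlation `κ`, and it controls the power of their linear combinations. -/
theorem exists_correlation {Ω : Type*} [MeasurableSpace Ω] {μ : Measure Ω} {N : ℕ} (hN : 0 < N)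
    {u v : Fin N → Ω → ℂ} (hu : ∀ i, Measurable (u i)) (hv : ∀ i, Measurable (v i))
    (hu2 : ∑ i, ∫⁻ ω, ‖u i ω‖ₑ ^ 2 ∂μ ≤ N) (hv2 : ∑ i, ∫⁻ ω, ‖v i ω‖ₑ ^ 2 ∂μ ≤ N) :
    ∃ κ : ℂ, ‖κ‖ ≤ 1 ∧ ∀ α β : ℂ, ∑ i, ∫⁻ ω, ‖α * u i ω + β * v i ω‖ₑ ^ 2 ∂μ ≤
      ENNReal.ofReal
        (N * (‖α‖ ^ 2 + ‖β‖ ^ 2 + 2 * ((starRingEnd ℂ) α * β * κ).re)) := by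
  have hN' : (0 : ℝ) < N := by exact_mod_cast hN
  have key : ∀ f : Ω → ℂ, (∫⁻ ω, ‖f ω‖ₑ ^ 2 ∂μ) = ∫⁻ ω, ENNReal.ofReal (‖f ω‖ ^ 2) ∂μ :=
    fun f => lintegral_congr fun ω => by
      rw [← ofReal_norm, ENNReal.ofReal_pow (norm_nonneg _)]
  have hmem : ∀ {w : Fin N → Ω → ℂ}, (∀ i, Measurable (w i)) →
      (∑ i, ∫⁻ ω, ‖w i ω‖ₑ ^ 2 ∂μ ≤ N) → ∀ i, MemLp (w i) 2 μ := by
    intro w hw h i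
    rw [memLp_two_iff_integrable_sq_norm (hw i).aestronglyMeasurable]
    refine ⟨by have := hw i; fun_prop, ?_⟩
    rw [hasFiniteIntegral_iff_ofReal (ae_of_all _ fun ω => by positivity), ← key]
    exact ((Finset.single_le_sum (f := fun i => ∫⁻ ω, ‖w i ω‖ₑ ^ 2 ∂μ)
      (fun _ _ => zero_le) (Finset.mem_univ i)).trans h).trans_lt (ENNReal.natCast_lt_top N)
  have hum := hmem hu hu2
  have hvm := hmem hv hv2
  have hreal : ∀ {w : Fin N → Ω → ℂ}, (∀ i, MemLp (w i) 2 μ) →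
      ∑ i, ∫⁻ ω, ‖w i ω‖ₑ ^ 2 ∂μ = ENNReal.ofReal (∑ i, ∫ ω, ‖w i ω‖ ^ 2 ∂μ) := by
    intro w hw
    rw [ENNReal.ofReal_sum_of_nonneg fun i _ => integral_nonneg fun ω => by positivity]
    refine Finset.sum_congr rfl fun i _ => ?_
    rw [key, ofReal_integral_eq_lintegral_ofReal
      ((memLp_two_iff_integrable_sq_norm (hw i).1).1 (hw i)) (ae_of_all _ fun ω => by positivity)]
  have hprod : ∀ i, Integrable (fun ω => v i ω * (starRingEnd ℂ) (u i ω)) μ := fun i =>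
    (hvm i).integrable_mul (hum i).star
  set A := ∑ i, ∫ ω, ‖u i ω‖ ^ 2 ∂μ
  set B := ∑ i, ∫ ω, ‖v i ω‖ ^ 2 ∂μ
  set K := ∑ i, ∫ ω, v i ω * (starRingEnd ℂ) (u i ω) ∂μ
  have hA : A ≤ N := by
    rw [hreal hum, ← ENNReal.ofReal_natCast, ENNReal.ofReal_le_ofReal_iff (by positivity)] at hu2
    exact hu2
  have hB : B ≤ N := by
    rw [hreal hvm, ← ENNReal.ofReal_natCast, ENNReal.ofReal_le_ofReal_iff (by positivity)] at hv2
    exact hv2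
  have hexp : ∀ α β : ℂ, ∑ i, ∫ ω, ‖α * u i ω + β * v i ω‖ ^ 2 ∂μ =
      ‖α‖ ^ 2 * A + ‖β‖ ^ 2 * B + 2 * ((starRingEnd ℂ) α * β * K).re := by
    intro α β
    simp only [A, B, K, Finset.mul_sum, Complex.re_sum, ← Finset.sum_add_distrib]
    refine Finset.sum_congr rfl fun i _ => ?_
    have h1 := (memLp_two_iff_integrable_sq_norm (hum i).1).1 (hum i)
    have h2 := (memLp_two_iff_integrable_sq_norm (hvm i).1).1 (hvm i)
    have h3 := (hprod i).const_mul ((starRingEnd ℂ) α * β)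
    rw [← integral_const_mul, ← integral_const_mul, ← integral_const_mul]
    have h4 : (∫ ω, (starRingEnd ℂ) α * β * (v i ω * (starRingEnd ℂ) (u i ω)) ∂μ).re =
        ∫ ω, ((starRingEnd ℂ) α * β * (v i ω * (starRingEnd ℂ) (u i ω))).re ∂μ :=
      (integral_re h3).symm
    have h5 : Integrable (fun ω =>
        2 * ((starRingEnd ℂ) α * β * (v i ω * (starRingEnd ℂ) (u i ω))).re) μ :=
      h3.re.const_mul 2
    have h6 : Integrable (fun ω => ‖α‖ ^ 2 * ‖u i ω‖ ^ 2 + ‖β‖ ^ 2 * ‖v i ω‖ ^ 2) μ :=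
      (h1.const_mul _).add (h2.const_mul _)
    rw [h4, ← integral_const_mul, ← integral_add (h1.const_mul _) (h2.const_mul _),
      ← integral_add h6 h5]
    refine integral_congr_ae (ae_of_all _ fun ω => ?_)
    simp only [← Complex.normSq_eq_norm_sq, Complex.normSq_apply, Complex.add_re, Complex.add_im,
      Complex.mul_re, Complex.mul_im, Complex.conj_re, Complex.conj_im]
    ring
  have hκ : K = N * (K / N) := by
    have : (N : ℂ) ≠ 0 := by exact_mod_cast hN.ne'
    field_simp
  have hbound : ∀ α β : ℂ, ∑ i, ∫ ω, ‖α * u i ω + β * v i ω‖ ^ 2 ∂μ ≤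
      N * (‖α‖ ^ 2 + ‖β‖ ^ 2 + 2 * ((starRingEnd ℂ) α * β * (K / N)).re) := by
    intro α β
    have h5 : ((starRingEnd ℂ) α * β * K).re =
        N * ((starRingEnd ℂ) α * β * (K / N)).re := by
      conv_lhs => rw [hκ]
      rw [mul_left_comm, ← Complex.ofReal_natCast, Complex.re_ofReal_mul]
    rw [hexp, h5]
    have := mul_le_mul_of_nonneg_left hA (sq_nonneg ‖α‖)
    have := mul_le_mul_of_nonneg_left hB (sq_nonneg ‖β‖)
    linarith
  refine ⟨K / N, ?_, fun α β => ?_⟩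
  -- Testing the bound on the residual `v - κ u` gives `0 ≤ 1 - ‖κ‖ ^ 2`.
  · have h0 : 0 ≤ ∑ i, ∫ ω, ‖-(K / N) * u i ω + 1 * v i ω‖ ^ 2 ∂μ :=
      Finset.sum_nonneg fun i _ => integral_nonneg fun ω => by positivity
    have h1 := h0.trans (hbound (-(K / N)) 1)
    have h2 := nonneg_of_mul_nonneg_right h1 hN'
    have h3 : ((starRingEnd ℂ) (-(K / N)) * 1 * (K / N)).re = -‖K / N‖ ^ 2 := by
      rw [mul_one, map_neg, neg_mul, mul_comm, Complex.mul_conj, Complex.normSq_eq_norm_sq]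
      simp [-norm_div]
      norm_cast
    rw [h3, norm_neg, norm_one] at h2
    exact (sq_le_one_iff₀ (norm_nonneg _)).1 (by linarith)
  · rw [hreal (w := fun i ω => α * u i ω + β * v i ω)
      fun i => ((hum i).const_mul α).add ((hvm i).const_mul β)]
    exact ENNReal.ofReal_le_ofReal (hbound α β)

/-! ### Measurability, causality and the volume-preserving map from noise to outputs. -/

namespace FeedbackCode

variable {N M₁ M₂ : ℕ} (C : FeedbackCode N M₁ M₂) (gd gc : ℂ)

theorem measurable_enc₁_prod (i : Fin N) :
    Measurable (fun p : Fin M₁ × (Fin i → ℂ) => C.enc₁ i p.1 p.2) :=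
  measurable_from_prod_countable_right fun w => C.measurable_enc₁ i w

theorem measurable_enc₂_prod (i : Fin N) :
    Measurable (fun p : Fin M₂ × (Fin i → ℂ) => C.enc₂ i p.1 p.2) :=
  measurable_from_prod_countable_right fun w => C.measurable_enc₂ i w

theorem measurable_X₁_of_past (i : Fin N)
    (h : ∀ j < i, Measurable (fun ω => C.Y₁ gd gc ω j)) :
    Measurable (fun ω => C.X₁ gd gc ω i) :=
  (C.measurable_enc₁_prod i).comp
    (measurable_fst.fst.prodMk (measurable_pi_lambda _ fun j => h _ j.2))

theorem measurable_X₂_of_past (i : Fin N)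
    (h : ∀ j < i, Measurable (fun ω => C.Y₂ gd gc ω j)) :
    Measurable (fun ω => C.X₂ gd gc ω i) :=
  (C.measurable_enc₂_prod i).comp
    (measurable_fst.snd.prodMk (measurable_pi_lambda _ fun j => h _ j.2))

theorem measurable_Y (i : Fin N) :
    Measurable (fun ω => C.Y₁ gd gc ω i) ∧ Measurable (fun ω => C.Y₂ gd gc ω i) := by
  induction i using WellFoundedLT.induction with
  | ind i ih =>
    have h1 := C.measurable_X₁_of_past gd gc i fun j hj => (ih j hj).1
    have h2 := C.measurable_X₂_of_past gd gc i fun j hj => (ih j hj).2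
    simp_rw [Y₁_eq, Y₂_eq]
    constructor <;> fun_prop

@[fun_prop]
theorem measurable_X₁ (i : Fin N) : Measurable (fun ω => C.X₁ gd gc ω i) :=
  C.measurable_X₁_of_past gd gc i fun j _ => (C.measurable_Y gd gc j).1

@[fun_prop]
theorem measurable_X₂ (i : Fin N) : Measurable (fun ω => C.X₂ gd gc ω i) :=
  C.measurable_X₂_of_past gd gc i fun j _ => (C.measurable_Y gd gc j).2

@[fun_prop]
theorem measurable_Y₁ : Measurable (fun ω => C.Y₁ gd gc ω) :=
  measurable_pi_lambda _ fun j => (C.measurable_Y gd gc j).1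

@[fun_prop]
theorem measurable_Y₂ : Measurable (fun ω => C.Y₂ gd gc ω) :=
  measurable_pi_lambda _ fun j => (C.measurable_Y gd gc j).2

/-- Outputs are causal functions of the noise. -/
theorem Y_congr {ω ω' : Sample N M₁ M₂} (hw : ω.1 = ω'.1) (i : Fin N)
    (h : ∀ j ≤ i, ω.2.1 j = ω'.2.1 j ∧ ω.2.2 j = ω'.2.2 j) :
    C.Y₁ gd gc ω i = C.Y₁ gd gc ω' i ∧ C.Y₂ gd gc ω i = C.Y₂ gd gc ω' i := by
  induction i using WellFoundedLT.induction with
  | ind i ih =>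
    have hY : ∀ j < i, _ := fun j hj => ih j hj fun k hk => h k (hk.trans hj.le)
    have h1 : C.X₁ gd gc ω i = C.X₁ gd gc ω' i := by
      unfold X₁; rw [hw]; congr 1; ext j; exact (hY _ j.2).1
    have h2 : C.X₂ gd gc ω i = C.X₂ gd gc ω' i := by
      unfold X₂; rw [hw]; congr 1; ext j; exact (hY _ j.2).2
    simp only [Y₁_eq, Y₂_eq, h1, h2, (h i le_rfl).1, (h i le_rfl).2, and_self]

/-- The inequality `j < i` is strict, unlike in `Y_congr`: an input does not see the noise of its
own time. This makes inputs orthogonal to the current noise. -/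
theorem X₁_congr {ω ω' : Sample N M₁ M₂} (hw : ω.1 = ω'.1) (i : Fin N)
    (h : ∀ j < i, ω.2.1 j = ω'.2.1 j ∧ ω.2.2 j = ω'.2.2 j) :
    C.X₁ gd gc ω i = C.X₁ gd gc ω' i := by
  unfold X₁; rw [hw]; congr 1; ext j
  exact (C.Y_congr gd gc hw _ fun k hk => h k (hk.trans_lt j.2)).1

theorem X₂_congr {ω ω' : Sample N M₁ M₂} (hw : ω.1 = ω'.1) (i : Fin N)
    (h : ∀ j < i, ω.2.1 j = ω'.2.1 j ∧ ω.2.2 j = ω'.2.2 j) :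
    C.X₂ gd gc ω i = C.X₂ gd gc ω' i := by
  unfold X₂; rw [hw]; congr 1; ext j
  exact (C.Y_congr gd gc hw _ fun k hk => h k (hk.trans_lt j.2)).2

/-- The noise recovered from the messages and the outputs. -/
def recoverNoise (w : Fin M₁ × Fin M₂) (y : (Fin N → ℂ) × (Fin N → ℂ)) :
    (Fin N → ℂ) × (Fin N → ℂ) :=
  (fun i => y.1 i - (gd * C.enc₁ i w.1 (fun j => y.1 ⟨j, j.2.trans i.2⟩) +
      gc * C.enc₂ i w.2 (fun j => y.2 ⟨j, j.2.trans i.2⟩)),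
    fun i => y.2 i - (gc * C.enc₁ i w.1 (fun j => y.1 ⟨j, j.2.trans i.2⟩) +
      gd * C.enc₂ i w.2 (fun j => y.2 ⟨j, j.2.trans i.2⟩)))

/-- The pair of output blocks as a function of the pair of noise blocks. -/
def outputs (w : Fin M₁ × Fin M₂) (z : (Fin N → ℂ) × (Fin N → ℂ)) :
    (Fin N → ℂ) × (Fin N → ℂ) :=
  (C.Y₁ gd gc (w, z), C.Y₂ gd gc (w, z))

theorem measurable_outputs (w : Fin M₁ × Fin M₂) : Measurable (C.outputs gd gc w) := by
  have h : Measurable (fun z : (Fin N → ℂ) × (Fin N → ℂ) => ((w, z) : Sample N M₁ M₂)) :=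
    measurable_prodMk_left
  exact ((C.measurable_Y₁ gd gc).comp h).prodMk ((C.measurable_Y₂ gd gc).comp h)

theorem outputs_recoverNoise (w : Fin M₁ × Fin M₂) (y : (Fin N → ℂ) × (Fin N → ℂ)) :
    C.outputs gd gc w (C.recoverNoise gd gc w y) = y := by
  have h : ∀ i, C.Y₁ gd gc (w, C.recoverNoise gd gc w y) i = y.1 i ∧
      C.Y₂ gd gc (w, C.recoverNoise gd gc w y) i = y.2 i := by
    intro i
    induction i using WellFoundedLT.induction with
    | ind i ih =>
      have h1 : C.X₁ gd gc (w, C.recoverNoise gd gc w y) i =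
          C.enc₁ i w.1 (fun j => y.1 ⟨j, j.2.trans i.2⟩) := by
        unfold X₁; congr 1; ext j; exact (ih _ j.2).1
      have h2 : C.X₂ gd gc (w, C.recoverNoise gd gc w y) i =
          C.enc₂ i w.2 (fun j => y.2 ⟨j, j.2.trans i.2⟩) := by
        unfold X₂; congr 1; ext j; exact (ih _ j.2).2
      rw [Y₁_eq, Y₂_eq, h1, h2]
      simp [recoverNoise]
  exact Prod.ext (funext fun i => (h i).1) (funext fun i => (h i).2)

/-- Interleaving the two blocks as a sequence in `ℂ × ℂ` turns this map into a triangular shear,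
since the inputs at time `i` depend only on outputs before `i`. -/
theorem measurePreserving_recoverNoise (w : Fin M₁ × Fin M₂) :
    MeasurePreserving (C.recoverNoise gd gc w) := by
  have e := volume_measurePreserving_arrowProdEquivProdArrow ℂ ℂ (Fin N)
  have : (volume : Measure (ℂ × ℂ)).IsAddHaarMeasure :=
    inferInstanceAs ((volume : Measure ℂ).prod (volume : Measure ℂ)).IsAddHaarMeasure
  have hs := measurePreserving_shear (volume : Measure (ℂ × ℂ)) N
    (fun i p => (-(gd * C.enc₁ i w.1 (fun j => (p j).1) + gc * C.enc₂ i w.2 (fun j => (p j).2)),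
      -(gc * C.enc₁ i w.1 (fun j => (p j).1) + gd * C.enc₂ i w.2 (fun j => (p j).2))))
    (fun i => by
      have h1 : Measurable fun p : Fin i → ℂ × ℂ => C.enc₁ i w.1 (fun j => (p j).1) :=
        (C.measurable_enc₁ i w.1).comp (by fun_prop)
      have h2 : Measurable fun p : Fin i → ℂ × ℂ => C.enc₂ i w.2 (fun j => (p j).2) :=
        (C.measurable_enc₂ i w.2).comp (by fun_prop)
      fun_prop)
  convert e.comp (hs.comp e.symm) using 1
  ext y i <;> simp [recoverNoise, sub_eq_add_neg, MeasurableEquiv.arrowProdEquivProdArrow,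
    Equiv.arrowProdEquivProdArrow]

theorem measurePreserving_outputs (w : Fin M₁ × Fin M₂) :
    MeasurePreserving (C.outputs gd gc w) := by
  refine ⟨C.measurable_outputs gd gc w, ?_⟩
  have h := C.measurePreserving_recoverNoise gd gc w
  -- A right inverse suffices: pushing Lebesgue measure forward through `recoverNoise` and then
  -- `outputs` is pushing it through the identity.
  conv_lhs => rw [← h.map_eq]
  rw [Measure.map_map (C.measurable_outputs gd gc w) h.measurable,
    show C.outputs gd gc w ∘ C.recoverNoise gd gc w = id from
      funext (C.outputs_recoverNoise gd gc w), Measure.map_id]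

end FeedbackCode

/-! ### Averaging over messages; Gaussian product densities; sign flips of the noise. -/

theorem isProbabilityMeasure_uniformOn_univ {M : ℕ} (hM : 0 < M) :
    IsProbabilityMeasure (uniformOn (Set.univ : Set (Fin M))) :=
  have : Nonempty (Fin M) := ⟨⟨0, hM⟩⟩
  isProbabilityMeasure_uniformOn Set.finite_univ Set.univ_nonempty

theorem isProbabilityMeasure_sampleLaw (N : ℕ) {M₁ M₂ : ℕ} (h₁ : 0 < M₁) (h₂ : 0 < M₂) :
    IsProbabilityMeasure (sampleLaw N M₁ M₂) := by
  have := isProbabilityMeasure_uniformOn_univ h₁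
  have := isProbabilityMeasure_uniformOn_univ h₂
  unfold sampleLaw
  infer_instance

theorem sampleLaw_apply {N M₁ M₂ : ℕ} (h₁ : 0 < M₁) (h₂ : 0 < M₂) {A : Set (Sample N M₁ M₂)}
    (hA : MeasurableSet A) :
    sampleLaw N M₁ M₂ A = ∑ w : Fin M₁ × Fin M₂, ((noiseLaw N).prod (noiseLaw N)) {z | (w, z) ∈ A}
      * ENNReal.ofReal ((M₁ * M₂ : ℝ)⁻¹) := by
  have := isProbabilityMeasure_uniformOn_univ h₁
  have := isProbabilityMeasure_uniformOn_univ h₂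
  have h₁' : (0 : ℝ) < M₁ := by exact_mod_cast h₁
  have h₂' : (0 : ℝ) < M₂ := by exact_mod_cast h₂
  unfold sampleLaw
  rw [Measure.prod_apply hA, lintegral_fintype]
  refine Finset.sum_congr rfl fun w _ => ?_
  congr 1
  rw [show ({w} : Set (Fin M₁ × Fin M₂)) = {w.1} ×ˢ {w.2} by simp, Measure.prod_prod,
    uniformOn_univ, uniformOn_univ, Measure.count_singleton, Measure.count_singleton,
    Fintype.card_fin, Fintype.card_fin, mul_inv, ENNReal.ofReal_mul (by positivity),
    ENNReal.ofReal_inv_of_pos h₁', ENNReal.ofReal_inv_of_pos h₂', ENNReal.ofReal_natCast,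
    ENNReal.ofReal_natCast, one_div, one_div]

theorem prod_complexGaussianPDF {N : ℕ} {v : ℝ} (hv : 0 < v) (x : Fin N → ℂ) :
    ∏ i, complexGaussianPDF v (x i) =
      ENNReal.ofReal ((Real.pi * v)⁻¹ ^ N * Real.exp (-∑ i, ‖x i‖ ^ 2 / v)) := by
  have := Real.pi_pos
  simp only [complexGaussianPDF]
  rw [← ENNReal.ofReal_prod_of_nonneg fun i _ => by positivity, Finset.prod_mul_distrib,
    Finset.prod_const, ← Real.exp_sum, Finset.sum_neg_distrib, Finset.card_univ, Fintype.card_fin]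

theorem lintegral_prod_complexGaussianPDF {N : ℕ} {v : ℝ} (hv : 0 < v) (m : Fin N → ℂ) :
    ∫⁻ y : Fin N → ℂ, ∏ i, complexGaussianPDF v (y i - m i) = 1 := by
  have h := lintegral_pi_prod (fun _ : Fin N => (volume : Measure ℂ))
    (fun i y => complexGaussianPDF v (y - m i)) (fun i => by fun_prop)
  refine h.trans (Finset.prod_eq_one fun i _ => ?_)
  rw [lintegral_sub_right_eq_self, lintegral_complexGaussianPDF hv]

/-- Negation of one noise sample. -/
def negAt {N : ℕ} (i : Fin N) (z : Fin N → ℂ) : Fin N → ℂ := fun j => if j = i then -z j else z j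

theorem measurePreserving_negAt {N : ℕ} (i : Fin N) :
    MeasurePreserving (negAt i) (noiseLaw N) (noiseLaw N) := by
  have h := measurePreserving_pi (fun _ : Fin N => stdComplexGaussian)
    (fun _ => stdComplexGaussian) (f := fun j z => if j = i then -z else z) (fun j => by
      by_cases hj : j = i
      · simpa only [hj, if_true] using measurePreserving_neg_stdComplexGaussian
      · simp only [hj, if_false]
        exact MeasurePreserving.id stdComplexGaussian)
  exact h

theorem ofReal_normSq_div (x : ℂ) (v : ℝ) :
    ENNReal.ofReal (‖x‖ ^ 2 / v) = ‖x‖ₑ ^ 2 * ENNReal.ofReal v⁻¹ := by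
  rw [div_eq_mul_inv, ENNReal.ofReal_mul (by positivity), ENNReal.ofReal_pow (norm_nonneg _),
    ofReal_norm]

/-! ### The reference law and the change of measure. -/

namespace FeedbackCode

variable {N M₁ M₂ : ℕ} (C : FeedbackCode N M₁ M₂) (gd gc : ℂ)

/-- A linear prediction of `Y₂ᵢ` from `X₁ᵢ` and `Y₁ᵢ`, in terms of `W₁` and the block `Y₁ᴺ`: the
input `X₂ᵢ` is first estimated by `a X₁ᵢ`, and the estimate is corrected with gain `c` from the
innovation at receiver 1. -/
def predictY₂ (a c : ℂ) (w : Fin M₁) (y : Fin N → ℂ) (i : Fin N) : ℂ :=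
  let x := C.enc₁ i w (fun j => y ⟨j, j.2.trans i.2⟩)
  gc * x + gd * (a * x) + c * (y i - gd * x - gc * (a * x))

theorem measurable_predictY₂ (a c : ℂ) (i : Fin N) :
    Measurable (fun p : Fin M₁ × (Fin N → ℂ) => C.predictY₂ gd gc a c p.1 p.2 i) := by
  have h : Measurable (fun p : Fin M₁ × (Fin N → ℂ) =>
      C.enc₁ i p.1 (fun j => p.2 ⟨j, j.2.trans i.2⟩)) :=
    (C.measurable_enc₁_prod i).comp (measurable_fst.prodMk (measurable_pi_lambda _ fun j =>
      (measurable_pi_apply _).comp measurable_snd))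
  unfold predictY₂
  fun_prop

theorem Y₂_sub_predictY₂ (a c : ℂ) (ω : Sample N M₁ M₂) (i : Fin N) :
    C.Y₂ gd gc ω i - C.predictY₂ gd gc a c ω.1.1 (C.Y₁ gd gc ω) i =
      (gd - c * gc) * (C.X₂ gd gc ω i - a * C.X₁ gd gc ω i) + (ω.2.2 i - c * ω.2.1 i) := by
  unfold predictY₂
  change _ - (gc * C.X₁ gd gc ω i + gd * (a * C.X₁ gd gc ω i) +
    c * (C.Y₁ gd gc ω i - gd * C.X₁ gd gc ω i - gc * (a * C.X₁ gd gc ω i))) = _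
  rw [Y₂_eq, Y₁_eq]
  ring

/-- The energy of the outputs normalized by the reference law, under which `Y₁ᵢ` has variance `vB`
and `Y₂ᵢ` has variance `vA` around its prediction. -/
noncomputable def refEnergy (a c : ℂ) (vA vB : ℝ) (w : Fin M₁) (y : (Fin N → ℂ) × (Fin N → ℂ)) : ℝ :=
  ∑ i, ‖y.1 i‖ ^ 2 / vB + ∑ i, ‖y.2 i - C.predictY₂ gd gc a c w y.1 i‖ ^ 2 / vA

theorem measurable_refEnergy (a c : ℂ) (vA vB : ℝ) :
    Measurable (fun p : Fin M₁ × ((Fin N → ℂ) × (Fin N → ℂ)) =>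
      C.refEnergy gd gc a c vA vB p.1 p.2) := by
  have h : ∀ i, Measurable (fun p : Fin M₁ × ((Fin N → ℂ) × (Fin N → ℂ)) =>
      C.predictY₂ gd gc a c p.1 p.2.1 i) := fun i =>
    (C.measurable_predictY₂ gd gc a c i).comp
      (f := fun p : Fin M₁ × ((Fin N → ℂ) × (Fin N → ℂ)) => (p.1, p.2.1)) (by fun_prop)
  unfold refEnergy
  fun_prop

/-- The density of the reference law of the outputs when user 1 sends `w`. -/
noncomputable def refPDF (a c : ℂ) (vA vB : ℝ) (w : Fin M₁) (y : (Fin N → ℂ) × (Fin N → ℂ)) :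
    ENNReal :=
  (∏ i, complexGaussianPDF vB (y.1 i)) *
    ∏ i, complexGaussianPDF vA (y.2 i - C.predictY₂ gd gc a c w y.1 i)

theorem measurable_refPDF (a c : ℂ) (vA vB : ℝ) (w : Fin M₁) :
    Measurable (C.refPDF gd gc a c vA vB w) := by
  have h : ∀ i, Measurable (fun p : (Fin N → ℂ) × (Fin N → ℂ) =>
      C.predictY₂ gd gc a c w p.1 i) := fun i =>
    (C.measurable_predictY₂ gd gc a c i).comp
      (f := fun p : (Fin N → ℂ) × (Fin N → ℂ) => (w, p.1)) (by fun_prop)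
  unfold refPDF
  refine Measurable.mul ?_ ?_ <;>
  · refine Finset.measurable_prod _ fun i _ => ?_
    have := h i
    fun_prop

/-- The powers of `π` cancel, so the likelihood ratio is `(vA * vB) ^ N` times the exponential of
the energy difference. -/
theorem noisePDF_le_refPDF (a c : ℂ) {vA vB t : ℝ} (hA : 0 < vA) (hB : 0 < vB) (w : Fin M₁)
    (y z : (Fin N → ℂ) × (Fin N → ℂ))
    (h : C.refEnergy gd gc a c vA vB w y - (∑ i, ‖z.1 i‖ ^ 2 + ∑ i, ‖z.2 i‖ ^ 2) ≤ N * t) :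
    (∏ i, complexGaussianPDF 1 (z.1 i)) * ∏ i, complexGaussianPDF 1 (z.2 i) ≤
      ENNReal.ofReal ((vA * vB) ^ N * Real.exp (N * t)) * C.refPDF gd gc a c vA vB w y := by
  have hpi := Real.pi_pos
  unfold refPDF
  rw [prod_complexGaussianPDF one_pos, prod_complexGaussianPDF one_pos,
    prod_complexGaussianPDF hB,
    prod_complexGaussianPDF hA (fun i => y.2 i - C.predictY₂ gd gc a c w y.1 i),
    ← ENNReal.ofReal_mul (by positivity), ← ENNReal.ofReal_mul (by positivity),
    ← ENNReal.ofReal_mul (by positivity)]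
  refine ENNReal.ofReal_le_ofReal ?_
  simp only [refEnergy] at h
  simp only [div_one, mul_one]
  set S₁ := ∑ i, ‖z.1 i‖ ^ 2
  set S₂ := ∑ i, ‖z.2 i‖ ^ 2
  set T₁ := ∑ i, ‖y.1 i‖ ^ 2 / vB
  set T₂ := ∑ i, ‖y.2 i - C.predictY₂ gd gc a c w y.1 i‖ ^ 2 / vA
  have e1 : Real.pi⁻¹ ^ N * Real.exp (-S₁) * (Real.pi⁻¹ ^ N * Real.exp (-S₂)) =
      (Real.pi⁻¹ ^ N * Real.pi⁻¹ ^ N) * Real.exp (-S₁ + -S₂) := by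
    rw [Real.exp_add]; ring
  have e2 : (vA * vB) ^ N * Real.exp (N * t) * ((Real.pi * vB)⁻¹ ^ N * Real.exp (-T₁) *
      ((Real.pi * vA)⁻¹ ^ N * Real.exp (-T₂))) =
      (Real.pi⁻¹ ^ N * Real.pi⁻¹ ^ N) * Real.exp (N * t + -T₁ + -T₂) := by
    rw [Real.exp_add, Real.exp_add]
    simp only [mul_inv, mul_pow, inv_pow]
    field_simp
  rw [e1, e2]
  exact mul_le_mul_of_nonneg_left (Real.exp_le_exp.2 (by linarith)) (by positivity)

/-- Under the reference laws, the decoding regions carry total mass one. -/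
theorem sum_lintegral_refPDF (a c : ℂ) {vA vB : ℝ} (hA : 0 < vA) (hB : 0 < vB) :
    ∑ w : Fin M₁ × Fin M₂, ∫⁻ y : (Fin N → ℂ) × (Fin N → ℂ),
      (if C.dec₁ y.1 = w.1 then (if C.dec₂ y.2 = w.2 then C.refPDF gd gc a c vA vB w.1 y else 0)
        else 0) = 1 := by
  have m1 : ∀ w, MeasurableSet {y : (Fin N → ℂ) × (Fin N → ℂ) | C.dec₁ y.1 = w} := fun w =>
    (C.measurable_dec₁.comp measurable_fst) (measurableSet_singleton w)
  have m2 : ∀ w, MeasurableSet {y : (Fin N → ℂ) × (Fin N → ℂ) | C.dec₂ y.2 = w} := fun w =>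
    (C.measurable_dec₂.comp measurable_snd) (measurableSet_singleton w)
  have m3 := C.measurable_refPDF gd gc a c vA vB
  have h1 : ∀ w₁, ∑ w₂, ∫⁻ y : (Fin N → ℂ) × (Fin N → ℂ),
      (if C.dec₁ y.1 = w₁ then (if C.dec₂ y.2 = w₂ then C.refPDF gd gc a c vA vB w₁ y else 0)
        else 0) =
      ∫⁻ y : Fin N → ℂ, if C.dec₁ y = w₁ then ∏ i, complexGaussianPDF vB (y i) else 0 := by
    intro w₁
    rw [← lintegral_finsetSum _ fun w₂ _ =>
      Measurable.ite (m1 w₁) (Measurable.ite (m2 w₂) (m3 w₁) measurable_const) measurable_const]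
    have : ∀ y : (Fin N → ℂ) × (Fin N → ℂ), ∑ w₂, (if C.dec₁ y.1 = w₁ then
        (if C.dec₂ y.2 = w₂ then C.refPDF gd gc a c vA vB w₁ y else 0) else 0) =
        if C.dec₁ y.1 = w₁ then C.refPDF gd gc a c vA vB w₁ y else 0 := by
      intro y
      by_cases h : C.dec₁ y.1 = w₁ <;> simp [h]
    simp_rw [this]
    rw [Measure.volume_eq_prod, lintegral_prod _
      (Measurable.ite (m1 w₁) (m3 w₁) measurable_const).aemeasurable]
    refine lintegral_congr fun y₁ => ?_
    by_cases h : C.dec₁ y₁ = w₁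
    · simp only [h, if_true, refPDF]
      -- With `y₁` and `w₁` fixed the prediction is a constant, so `Y₂` integrates out to one.
      rw [lintegral_const_mul _ (Finset.measurable_prod _ fun i _ => by fun_prop),
        lintegral_prod_complexGaussianPDF hA, mul_one]
    · simp [h]
  rw [Fintype.sum_prod_type]
  simp_rw [h1]
  have m4 : ∀ w, MeasurableSet {y : Fin N → ℂ | C.dec₁ y = w} := fun w =>
    C.measurable_dec₁ (measurableSet_singleton w)
  have m5 : Measurable fun y : Fin N → ℂ => ∏ i, complexGaussianPDF vB (y i) :=
    Finset.measurable_prod _ fun i _ => by fun_prop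
  rw [← lintegral_finsetSum _ fun w₁ _ => Measurable.ite (m4 w₁) m5 measurable_const]
  simp only [Finset.sum_ite_eq, Finset.mem_univ, if_true]
  simpa using lintegral_prod_complexGaussianPDF (N := N) hB 0

/-- Correct decoding while the outputs are typical for the reference law is unlikely when there are
many messages. -/
theorem sampleLaw_correct_le (h₁ : 0 < M₁) (h₂ : 0 < M₂) (a c : ℂ) {vA vB : ℝ} (t : ℝ)
    (hA : 0 < vA) (hB : 0 < vB) :
    sampleLaw N M₁ M₂ {ω | C.dec₁ (C.Y₁ gd gc ω) = ω.1.1 ∧ C.dec₂ (C.Y₂ gd gc ω) = ω.1.2 ∧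
      C.refEnergy gd gc a c vA vB ω.1.1 (C.Y₁ gd gc ω, C.Y₂ gd gc ω) -
        (∑ i, ‖ω.2.1 i‖ ^ 2 + ∑ i, ‖ω.2.2 i‖ ^ 2) ≤ N * t} ≤
      ENNReal.ofReal ((vA * vB) ^ N * Real.exp (N * t) / (M₁ * M₂)) := by
  have hE : Measurable fun ω : Sample N M₁ M₂ =>
      C.refEnergy gd gc a c vA vB ω.1.1 (C.Y₁ gd gc ω, C.Y₂ gd gc ω) :=
    (C.measurable_refEnergy gd gc a c vA vB).comp
      (f := fun ω : Sample N M₁ M₂ => (ω.1.1, (C.Y₁ gd gc ω, C.Y₂ gd gc ω))) (by fun_prop)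
  have m1 : MeasurableSet {ω : Sample N M₁ M₂ | C.dec₁ (C.Y₁ gd gc ω) = ω.1.1} :=
    measurableSet_eq_fun (C.measurable_dec₁.comp (C.measurable_Y₁ gd gc)) (by fun_prop)
  have m2 : MeasurableSet {ω : Sample N M₁ M₂ | C.dec₂ (C.Y₂ gd gc ω) = ω.1.2} :=
    measurableSet_eq_fun (C.measurable_dec₂.comp (C.measurable_Y₂ gd gc)) (by fun_prop)
  have m3 : MeasurableSet {ω : Sample N M₁ M₂ |
      C.refEnergy gd gc a c vA vB ω.1.1 (C.Y₁ gd gc ω, C.Y₂ gd gc ω) -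
        (∑ i, ‖ω.2.1 i‖ ^ 2 + ∑ i, ‖ω.2.2 i‖ ^ 2) ≤ N * t} :=
    measurableSet_le (by fun_prop) measurable_const
  have hm := m1.inter (m2.inter m3)
  refine (sampleLaw_apply h₁ h₂ hm).le.trans ?_
  have hn : (noiseLaw N).prod (noiseLaw N) = volume.withDensity
      (fun z : (Fin N → ℂ) × (Fin N → ℂ) =>
        (∏ i, complexGaussianPDF 1 (z.1 i)) * ∏ i, complexGaussianPDF 1 (z.2 i)) := by
    have hp : Measurable fun z : Fin N → ℂ => ∏ i, complexGaussianPDF 1 (z i) :=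
      Finset.measurable_prod _ fun i _ => by fun_prop
    rw [noiseLaw_eq_withDensity, prod_withDensity hp hp, Measure.volume_eq_prod]
  have hw : ∀ w : Fin M₁ × Fin M₂, ((noiseLaw N).prod (noiseLaw N)) {z | (w, z) ∈
      ({ω : Sample N M₁ M₂ | C.dec₁ (C.Y₁ gd gc ω) = ω.1.1} ∩
      ({ω : Sample N M₁ M₂ | C.dec₂ (C.Y₂ gd gc ω) = ω.1.2} ∩ {ω : Sample N M₁ M₂ |
      C.refEnergy gd gc a c vA vB ω.1.1 (C.Y₁ gd gc ω, C.Y₂ gd gc ω) -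
        (∑ i, ‖ω.2.1 i‖ ^ 2 + ∑ i, ‖ω.2.2 i‖ ^ 2) ≤ N * t}))} ≤
      ENNReal.ofReal ((vA * vB) ^ N * Real.exp (N * t)) *
        ∫⁻ y : (Fin N → ℂ) × (Fin N → ℂ), (if C.dec₁ y.1 = w.1 then
          (if C.dec₂ y.2 = w.2 then C.refPDF gd gc a c vA vB w.1 y else 0) else 0) := by
    intro w
    have n1 : MeasurableSet {y : (Fin N → ℂ) × (Fin N → ℂ) | C.dec₁ y.1 = w.1} :=
      (C.measurable_dec₁.comp measurable_fst) (measurableSet_singleton w.1)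
    have n2 : MeasurableSet {y : (Fin N → ℂ) × (Fin N → ℂ) | C.dec₂ y.2 = w.2} :=
      (C.measurable_dec₂.comp measurable_snd) (measurableSet_singleton w.2)
    have hmi : Measurable fun y : (Fin N → ℂ) × (Fin N → ℂ) => if C.dec₁ y.1 = w.1 then
        (if C.dec₂ y.2 = w.2 then C.refPDF gd gc a c vA vB w.1 y else 0) else 0 :=
      Measurable.ite n1 (Measurable.ite n2 (C.measurable_refPDF gd gc a c vA vB w.1)
        measurable_const) measurable_const
    have hms := hm.preimage (measurable_prodMk_left (x := w))
    rw [hn]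
    refine (withDensity_apply _ hms).le.trans ?_
    -- Both integrals are now over the noise, because `outputs` preserves volume; it remains to
    -- compare the integrands pointwise on the event.
    rw [← lintegral_indicator hms, ← (C.measurePreserving_outputs gd gc w).lintegral_comp hmi,
      ← lintegral_const_mul' _ _ ENNReal.ofReal_ne_top]
    · refine lintegral_mono ?_
      refine Set.indicator_le' (fun z hz => ?_) (fun _ _ => zero_le)
      obtain ⟨hz1, hz2, hz3⟩ := hz
      rw [if_pos (show C.dec₁ (C.outputs gd gc w z).1 = w.1 from hz1),
        if_pos (show C.dec₂ (C.outputs gd gc w z).2 = w.2 from hz2)]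
      exact C.noisePDF_le_refPDF gd gc a c hA hB w.1 _ z hz3
  refine (Finset.sum_le_sum fun w _ => mul_le_mul_left (hw w) _).trans ?_
  rw [← Finset.sum_mul, ← Finset.mul_sum, C.sum_lintegral_refPDF gd gc a c hA hB, mul_one,
    ← ENNReal.ofReal_mul (by positivity), div_eq_mul_inv]

end FeedbackCode

/-! ### Energy of the outputs under the power constraint. -/

/-- The variance of the output of receiver 1 when unit power inputs have correlation `ρ`, aligned
with the channel. -/
noncomputable def outputVar (gd gc : ℂ) (ρ : ℝ) : ℝ :=
  1 + SNR gd + INR gc + 2 * ρ * Real.sqrt (SNR gd * INR gc)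

/-- The conditional variance of `Y₂` given `X₁` and `Y₁` when unit power Gaussian inputs have
correlation of modulus `ρ`. -/
noncomputable def condVar (gd gc : ℂ) (ρ : ℝ) : ℝ :=
  1 + (1 - ρ ^ 2) * SNR gd / (1 + (1 - ρ ^ 2) * INR gc)

theorem one_le_outputVar (gd gc : ℂ) {ρ : ℝ} (h0 : 0 ≤ ρ) : 1 ≤ outputVar gd gc ρ := by
  unfold outputVar SNR INR
  have : 0 ≤ 2 * ρ * Real.sqrt (‖gd‖ ^ 2 * ‖gc‖ ^ 2) := by positivity
  nlinarith [sq_nonneg ‖gd‖, sq_nonneg ‖gc‖]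

theorem one_le_condVar (gd gc : ℂ) {ρ : ℝ} (h0 : 0 ≤ ρ) (h1 : ρ ≤ 1) : 1 ≤ condVar gd gc ρ := by
  have h : 0 ≤ 1 - ρ ^ 2 := by nlinarith
  unfold condVar SNR INR
  have : 0 ≤ (1 - ρ ^ 2) * ‖gd‖ ^ 2 / (1 + (1 - ρ ^ 2) * ‖gc‖ ^ 2) := by positivity
  linarith

theorem lintegral_noise₁ {N M₁ M₂ : ℕ} (h₁ : 0 < M₁) (h₂ : 0 < M₂) (i : Fin N) :
    ∫⁻ ω, ‖ω.2.1 i‖ₑ ^ 2 ∂(sampleLaw N M₁ M₂) = 1 := by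
  have := isProbabilityMeasure_uniformOn_univ h₁
  have := isProbabilityMeasure_uniformOn_univ h₂
  have h : MeasurePreserving (fun ω : Sample N M₁ M₂ => ω.2.1 i) (sampleLaw N M₁ M₂)
      stdComplexGaussian :=
    (measurePreserving_eval (fun _ => stdComplexGaussian) i).comp
      (measurePreserving_fst.comp measurePreserving_snd)
  rw [← lintegral_enorm_sq_stdComplexGaussian, ← h.lintegral_comp (by fun_prop)]

theorem lintegral_noise₂ {N M₁ M₂ : ℕ} (h₁ : 0 < M₁) (h₂ : 0 < M₂) (i : Fin N) :
    ∫⁻ ω, ‖ω.2.2 i‖ₑ ^ 2 ∂(sampleLaw N M₁ M₂) = 1 := by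
  have := isProbabilityMeasure_uniformOn_univ h₁
  have := isProbabilityMeasure_uniformOn_univ h₂
  have h : MeasurePreserving (fun ω : Sample N M₁ M₂ => ω.2.2 i) (sampleLaw N M₁ M₂)
      stdComplexGaussian :=
    (measurePreserving_eval (fun _ => stdComplexGaussian) i).comp
      (measurePreserving_snd.comp measurePreserving_snd)
  rw [← lintegral_enorm_sq_stdComplexGaussian, ← h.lintegral_comp (by fun_prop)]

/-- Flipping one receiver's noise decorrelates the two noises; flipping both, as in the next lemma,
decorrelates inputs from noise. -/
theorem measurePreserving_negAt_snd {N M₁ M₂ : ℕ} (h₁ : 0 < M₁) (h₂ : 0 < M₂) (i : Fin N) :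
    MeasurePreserving (fun ω : Sample N M₁ M₂ => (ω.1, (ω.2.1, negAt i ω.2.2)))
      (sampleLaw N M₁ M₂) (sampleLaw N M₁ M₂) := by
  have := isProbabilityMeasure_uniformOn_univ h₁
  have := isProbabilityMeasure_uniformOn_univ h₂
  exact (MeasurePreserving.id _).prod ((MeasurePreserving.id _).prod (measurePreserving_negAt i))

theorem measurePreserving_negAt_both {N M₁ M₂ : ℕ} (h₁ : 0 < M₁) (h₂ : 0 < M₂) (i : Fin N) :
    MeasurePreserving (fun ω : Sample N M₁ M₂ => (ω.1, (negAt i ω.2.1, negAt i ω.2.2)))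
      (sampleLaw N M₁ M₂) (sampleLaw N M₁ M₂) := by
  have := isProbabilityMeasure_uniformOn_univ h₁
  have := isProbabilityMeasure_uniformOn_univ h₂
  exact (MeasurePreserving.id _).prod
    ((measurePreserving_negAt i).prod (measurePreserving_negAt i))

theorem lintegral_noise_sub {N M₁ M₂ : ℕ} (h₁ : 0 < M₁) (h₂ : 0 < M₂) (c : ℂ) (i : Fin N) :
    ∫⁻ ω, ‖ω.2.2 i - c * ω.2.1 i‖ₑ ^ 2 ∂(sampleLaw N M₁ M₂) = ENNReal.ofReal (1 + ‖c‖ ^ 2) := by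
  have h := lintegral_enorm_add_sq_of_symmetry (measurePreserving_negAt_snd h₁ h₂ i)
    (u := fun ω => -(c * ω.2.1 i)) (v := fun ω => ω.2.2 i) (by fun_prop) (by fun_prop)
    (fun ω => rfl) (fun ω => by simp [negAt])
  have e : ∀ ω : Sample N M₁ M₂, -(c * ω.2.1 i) + ω.2.2 i = ω.2.2 i - c * ω.2.1 i :=
    fun ω => by ring
  simp only [e, enorm_neg, enorm_mul, mul_pow] at h
  rw [h, lintegral_const_mul _ (by fun_prop), lintegral_noise₁ h₁ h₂, lintegral_noise₂ h₁ h₂,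
    ENNReal.ofReal_add (by norm_num) (by positivity), ENNReal.ofReal_pow (norm_nonneg _),
    ofReal_norm, ENNReal.ofReal_one, mul_one, add_comm]

namespace FeedbackCode

variable {N M₁ M₂ : ℕ} (C : FeedbackCode N M₁ M₂) (gd gc : ℂ)

/-- Inputs are uncorrelated with the current noise. -/
theorem lintegral_input_add_noise (h₁ : 0 < M₁) (h₂ : 0 < M₂) (i : Fin N) (α β γ δ : ℂ) :
    ∫⁻ ω, ‖(α * C.X₁ gd gc ω i + β * C.X₂ gd gc ω i) + (γ * ω.2.1 i + δ * ω.2.2 i)‖ₑ ^ 2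
        ∂(sampleLaw N M₁ M₂) =
      ∫⁻ ω, ‖α * C.X₁ gd gc ω i + β * C.X₂ gd gc ω i‖ₑ ^ 2 ∂(sampleLaw N M₁ M₂) +
      ∫⁻ ω, ‖γ * ω.2.1 i + δ * ω.2.2 i‖ₑ ^ 2 ∂(sampleLaw N M₁ M₂) := by
  refine lintegral_enorm_add_sq_of_symmetry (measurePreserving_negAt_both h₁ h₂ i)
    (u := fun ω => α * C.X₁ gd gc ω i + β * C.X₂ gd gc ω i)
    (v := fun ω => γ * ω.2.1 i + δ * ω.2.2 i)
    (by fun_prop) (by fun_prop) (fun ω => ?_) (fun ω => ?_)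
  · have hn : ∀ j < i, negAt i ω.2.1 j = ω.2.1 j ∧ negAt i ω.2.2 j = ω.2.2 j := fun j hj => by
      simp [negAt, hj.ne]
    congr 2
    · exact C.X₁_congr gd gc (ω := (ω.1, (negAt i ω.2.1, negAt i ω.2.2))) (ω' := ω) rfl i hn
    · exact C.X₂_congr gd gc (ω := (ω.1, (negAt i ω.2.1, negAt i ω.2.2))) (ω' := ω) rfl i hn
  · simp [negAt]
    ring

/-- Each of the two normalized energies contributes at most `N`, provided that `ρ` and the predictor
are matched to the correlation of this code; hence they depend on the code. -/
theorem exists_lintegral_refEnergy_le (h₁ : 0 < M₁) (h₂ : 0 < M₂) (hN : 0 < N)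
    (hP : C.PowerConstraint gd gc) :
    ∃ ρ : ℝ, 0 ≤ ρ ∧ ρ ≤ 1 ∧ ∃ a c : ℂ, ∫⁻ ω, ENNReal.ofReal
      (C.refEnergy gd gc a c (condVar gd gc ρ) (outputVar gd gc ρ) ω.1.1
        (C.Y₁ gd gc ω, C.Y₂ gd gc ω)) ∂(sampleLaw N M₁ M₂) ≤ ENNReal.ofReal (2 * N) := by
  obtain ⟨κ, hκ, hcorr⟩ := exists_correlation hN (C.measurable_X₁ gd gc) (C.measurable_X₂ gd gc)
    hP.1 hP.2
  have hN' : (0 : ℝ) < N := by exact_mod_cast hN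
  have hκ0 := norm_nonneg κ
  set s : ℝ := 1 - ‖κ‖ ^ 2 with hs
  have hs0 : 0 ≤ s := by rw [hs]; nlinarith
  set D : ℝ := 1 + s * ‖gc‖ ^ 2 with hD
  have hD0 : 0 < D := by positivity
  -- `c` is the minimum mean square gain for estimating `gd V + Z₂` from `gc V + Z₁`, where `V = X₂
  -- - κ X₁` is assigned variance `s`; `D` is then the variance of the observation.
  set c : ℂ := gd * (starRingEnd ℂ) gc * s / D with hc
  have hA1 := one_le_condVar gd gc hκ0 hκ
  have hB1 := one_le_outputVar gd gc (ρ := ‖κ‖) hκ0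
  refine ⟨‖κ‖, hκ0, hκ, κ, c, ?_⟩
  set vA := condVar gd gc ‖κ‖ with hvA
  set vB := outputVar gd gc ‖κ‖ with hvB
  have hA0 : 0 < vA := by linarith
  have hB0 : 0 < vB := by linarith
  have hout : ∑ i, ∫⁻ ω, ‖C.Y₁ gd gc ω i‖ₑ ^ 2 ∂(sampleLaw N M₁ M₂) ≤
      ENNReal.ofReal (N * vB) := by
    have e : ∀ i, ∫⁻ ω, ‖C.Y₁ gd gc ω i‖ₑ ^ 2 ∂(sampleLaw N M₁ M₂) =
        ∫⁻ ω, ‖gd * C.X₁ gd gc ω i + gc * C.X₂ gd gc ω i‖ₑ ^ 2 ∂(sampleLaw N M₁ M₂) + 1 := by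
      intro i
      have := C.lintegral_input_add_noise gd gc h₁ h₂ i gd gc 1 0
      simp only [one_mul, zero_mul, add_zero, lintegral_noise₁ h₁ h₂] at this
      rw [← this]
      simp only [Y₁_eq]
    simp_rw [e]
    rw [Finset.sum_add_distrib]
    refine (add_le_add_left (hcorr gd gc) _).trans ?_
    -- Nonnegativity is needed to add inside `ENNReal.ofReal`, which truncates at zero.
    have hnn : 0 ≤ ‖gd‖ ^ 2 + ‖gc‖ ^ 2 + 2 * ((starRingEnd ℂ) gd * gc * κ).re := by
      have h := Complex.abs_re_le_norm ((starRingEnd ℂ) gd * gc * κ)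
      rw [norm_mul, norm_mul, RCLike.norm_conj] at h
      have h' := neg_abs_le ((starRingEnd ℂ) gd * gc * κ).re
      have : ‖gd‖ * ‖gc‖ * ‖κ‖ ≤ ‖gd‖ * ‖gc‖ := mul_le_of_le_one_right (by positivity) hκ
      nlinarith [sq_nonneg (‖gd‖ - ‖gc‖)]
    simp only [Finset.sum_const, Finset.card_univ, Fintype.card_fin, nsmul_eq_mul, mul_one]
    rw [← ENNReal.ofReal_natCast, ← ENNReal.ofReal_add (by positivity) (by positivity)]
    refine ENNReal.ofReal_le_ofReal ?_
    -- The phase of `κ` is discarded: the worst case is a correlation aligned with the channel.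
    have h := (Complex.re_le_norm ((starRingEnd ℂ) gd * gc * κ))
    rw [norm_mul, norm_mul, RCLike.norm_conj] at h
    have hsq : Real.sqrt (SNR gd * INR gc) = ‖gd‖ * ‖gc‖ := by
      unfold SNR INR
      rw [← mul_pow, Real.sqrt_sq (by positivity)]
    rw [hvB, outputVar, hsq]
    unfold SNR INR
    nlinarith
  have hres : ∑ i, ∫⁻ ω, ‖C.Y₂ gd gc ω i - C.predictY₂ gd gc κ c ω.1.1 (C.Y₁ gd gc ω) i‖ₑ ^ 2
      ∂(sampleLaw N M₁ M₂) ≤ ENNReal.ofReal (N * vA) := by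
    have e : ∀ i, ∫⁻ ω, ‖C.Y₂ gd gc ω i - C.predictY₂ gd gc κ c ω.1.1 (C.Y₁ gd gc ω) i‖ₑ ^ 2
        ∂(sampleLaw N M₁ M₂) =
        ∫⁻ ω, ‖(-((gd - c * gc) * κ)) * C.X₁ gd gc ω i + (gd - c * gc) * C.X₂ gd gc ω i‖ₑ ^ 2
          ∂(sampleLaw N M₁ M₂) + ENNReal.ofReal (1 + ‖c‖ ^ 2) := by
      intro i
      have h := C.lintegral_input_add_noise gd gc h₁ h₂ i (-((gd - c * gc) * κ)) (gd - c * gc)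
        (-c) 1
      have e1 : ∀ ω : Sample N M₁ M₂, -c * ω.2.1 i + 1 * ω.2.2 i = ω.2.2 i - c * ω.2.1 i :=
        fun ω => by ring
      simp only [e1, lintegral_noise_sub h₁ h₂] at h
      rw [← h]
      refine lintegral_congr fun ω => ?_
      rw [Y₂_sub_predictY₂]
      congr 3
      ring
    simp_rw [e]
    rw [Finset.sum_add_distrib]
    refine (add_le_add_left (hcorr _ _) _).trans ?_
    have hg : gd - c * gc = gd / D := by
      have hD' : (D : ℂ) ≠ 0 := by exact_mod_cast hD0.ne'
      have h1 : (starRingEnd ℂ) gc * gc = ((‖gc‖ ^ 2 : ℝ) : ℂ) := by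
        rw [mul_comm, Complex.mul_conj, Complex.normSq_eq_norm_sq]
      have h2 : (D : ℂ) = 1 + s * ((‖gc‖ ^ 2 : ℝ) : ℂ) := by rw [hD]; push_cast; ring
      have h3 : c * gc = gd * s * ((‖gc‖ ^ 2 : ℝ) : ℂ) / D := by rw [hc, ← h1]; ring
      rw [h3]
      field_simp
      rw [h2]
      ring
    have hre : ((starRingEnd ℂ) (-((gd - c * gc) * κ)) * (gd - c * gc) * κ).re =
        -(‖gd - c * gc‖ ^ 2 * ‖κ‖ ^ 2) := by
      have : (starRingEnd ℂ) (-((gd - c * gc) * κ)) * (gd - c * gc) * κ =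
          -((((gd - c * gc) * κ) * (starRingEnd ℂ) ((gd - c * gc) * κ))) := by
        rw [map_neg]; ring
      rw [this, Complex.mul_conj, Complex.normSq_eq_norm_sq, norm_mul, ← mul_pow, Complex.neg_re,
        Complex.ofReal_re]
    have hgn : ‖gd - c * gc‖ ^ 2 = ‖gd‖ ^ 2 / D ^ 2 := by
      rw [hg, norm_div, div_pow, Complex.norm_real, Real.norm_eq_abs, sq_abs]
    have hcn : ‖c‖ ^ 2 = ‖gd‖ ^ 2 * ‖gc‖ ^ 2 * s ^ 2 / D ^ 2 := by
      rw [hc, norm_div, norm_mul, norm_mul, RCLike.norm_conj, Complex.norm_real, Complex.norm_real,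
        Real.norm_eq_abs, Real.norm_eq_abs, div_pow, mul_pow, mul_pow, sq_abs, sq_abs]
    rw [hre, norm_neg, norm_mul, mul_pow, hgn, hcn]
    have hfin : ‖gd‖ ^ 2 / D ^ 2 * ‖κ‖ ^ 2 + ‖gd‖ ^ 2 / D ^ 2 +
        2 * -(‖gd‖ ^ 2 / D ^ 2 * ‖κ‖ ^ 2) = ‖gd‖ ^ 2 / D ^ 2 * s := by rw [hs]; ring
    rw [hfin]
    simp only [Finset.sum_const, Finset.card_univ, Fintype.card_fin, nsmul_eq_mul]
    rw [← ENNReal.ofReal_natCast, ← ENNReal.ofReal_mul (by positivity),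
      ← ENNReal.ofReal_add (by positivity) (by positivity)]
    refine ENNReal.ofReal_le_ofReal (le_of_eq ?_)
    have : vA = 1 + s * ‖gd‖ ^ 2 / D := rfl
    rw [this]
    field_simp
    rw [hD]
    ring
  have hY₁ : ∀ i, Measurable fun ω => C.Y₁ gd gc ω i := fun i => (C.measurable_Y gd gc i).1
  have hY₂ : ∀ i, Measurable fun ω => C.Y₂ gd gc ω i := fun i => (C.measurable_Y gd gc i).2
  have hpred : ∀ i, Measurable fun ω => C.predictY₂ gd gc κ c ω.1.1 (C.Y₁ gd gc ω) i := fun i =>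
    (C.measurable_predictY₂ gd gc κ c i).comp
      (f := fun ω : Sample N M₁ M₂ => (ω.1.1, C.Y₁ gd gc ω)) (by fun_prop)
  have hscale : ∀ v : ℝ, 0 < v → ENNReal.ofReal (N * v) * ENNReal.ofReal v⁻¹ = N := fun v hv => by
    rw [← ENNReal.ofReal_mul (by positivity), mul_assoc, mul_inv_cancel₀ hv.ne', mul_one,
      ENNReal.ofReal_natCast]
  calc ∫⁻ ω, ENNReal.ofReal (C.refEnergy gd gc κ c vA vB ω.1.1
        (C.Y₁ gd gc ω, C.Y₂ gd gc ω)) ∂(sampleLaw N M₁ M₂)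
      = ∫⁻ ω, (∑ i, ‖C.Y₁ gd gc ω i‖ₑ ^ 2 * ENNReal.ofReal vB⁻¹ +
          ∑ i, ‖C.Y₂ gd gc ω i - C.predictY₂ gd gc κ c ω.1.1 (C.Y₁ gd gc ω) i‖ₑ ^ 2 *
            ENNReal.ofReal vA⁻¹) ∂(sampleLaw N M₁ M₂) := by
        refine lintegral_congr fun ω => ?_
        unfold refEnergy
        rw [ENNReal.ofReal_add (Finset.sum_nonneg fun i _ => by positivity)
          (Finset.sum_nonneg fun i _ => by positivity),
          ENNReal.ofReal_sum_of_nonneg fun i _ => by positivity,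
          ENNReal.ofReal_sum_of_nonneg fun i _ => by positivity]
        simp_rw [ofReal_normSq_div]
    _ = (∑ i, ∫⁻ ω, ‖C.Y₁ gd gc ω i‖ₑ ^ 2 ∂(sampleLaw N M₁ M₂)) * ENNReal.ofReal vB⁻¹ +
        (∑ i, ∫⁻ ω, ‖C.Y₂ gd gc ω i - C.predictY₂ gd gc κ c ω.1.1 (C.Y₁ gd gc ω) i‖ₑ ^ 2
          ∂(sampleLaw N M₁ M₂)) * ENNReal.ofReal vA⁻¹ := by
        rw [lintegral_add_left (by fun_prop), lintegral_finsetSum _ fun i _ => by fun_prop,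
          lintegral_finsetSum _ fun i _ => by have := hY₂ i; have := hpred i; fun_prop,
          Finset.sum_mul, Finset.sum_mul]
        congr 1 <;> refine Finset.sum_congr rfl fun i _ => ?_
        · rw [lintegral_mul_const _ (by fun_prop)]
        · have := hY₂ i
          have := hpred i
          rw [lintegral_mul_const _ (by fun_prop)]
    _ ≤ ENNReal.ofReal (N * vB) * ENNReal.ofReal vB⁻¹ +
        ENNReal.ofReal (N * vA) * ENNReal.ofReal vA⁻¹ := by gcongr
    _ = ENNReal.ofReal (2 * N) := by
        rw [hscale _ hA0, hscale _ hB0, two_mul, ENNReal.ofReal_add hN'.le hN'.le,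
          ENNReal.ofReal_natCast]

end FeedbackCode

/-! ### The converse for one code, and its limit. -/

namespace FeedbackCode

variable {N M₁ M₂ : ℕ} (C : FeedbackCode N M₁ M₂) (gd gc : ℂ)

/-- The converse for a single code: its error probabilities cannot both be small if it has many
messages. -/
theorem one_le_error_add (h₁ : 0 < M₁) (h₂ : 0 < M₂) (hN : 0 < N)
    (hP : C.PowerConstraint gd gc) {t : ℝ} (ht : 0 < t) :
    ∃ ρ : ℝ, 0 ≤ ρ ∧ ρ ≤ 1 ∧ 1 ≤ C.error₁ gd gc + (C.error₂ gd gc +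
      (ENNReal.ofReal ((condVar gd gc ρ * outputVar gd gc ρ) ^ N * Real.exp (N * t) / (M₁ * M₂)) +
      (ENNReal.ofReal (2 / (2 + t / 2)) +
      (ENNReal.ofReal (Var[fun z : ℂ => ‖z‖ ^ 2; stdComplexGaussian] / (N * (t / 4) ^ 2)) +
      ENNReal.ofReal (Var[fun z : ℂ => ‖z‖ ^ 2; stdComplexGaussian] / (N * (t / 4) ^ 2)))))) := by
  obtain ⟨ρ, h0, h1, a, c, hE⟩ := C.exists_lintegral_refEnergy_le gd gc h₁ h₂ hN hP
  refine ⟨ρ, h0, h1, ?_⟩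
  have hN' : (0 : ℝ) < N := by exact_mod_cast hN
  have hA0 : 0 < condVar gd gc ρ := one_pos.trans_le (one_le_condVar gd gc h0 h1)
  have hB0 : 0 < outputVar gd gc ρ := one_pos.trans_le (one_le_outputVar gd gc h0)
  have hprob := isProbabilityMeasure_sampleLaw N h₁ h₂
  have := isProbabilityMeasure_uniformOn_univ h₁
  have := isProbabilityMeasure_uniformOn_univ h₂
  set T : Sample N M₁ M₂ → ℝ := fun ω => C.refEnergy gd gc a c (condVar gd gc ρ)
    (outputVar gd gc ρ) ω.1.1 (C.Y₁ gd gc ω, C.Y₂ gd gc ω) with hT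
  have hTm : Measurable T := (C.measurable_refEnergy gd gc a c _ _).comp
    (f := fun ω : Sample N M₁ M₂ => (ω.1.1, (C.Y₁ gd gc ω, C.Y₂ gd gc ω))) (by fun_prop)
  have hcorrect := C.sampleLaw_correct_le gd gc h₁ h₂ a c t hA0 hB0
  have hmarkov : sampleLaw N M₁ M₂ {ω | N * (2 + t / 2) ≤ T ω} ≤
      ENNReal.ofReal (2 / (2 + t / 2)) := by
    have hpos : 0 < N * (2 + t / 2) := by positivity
    have h := meas_ge_le_lintegral_div (μ := sampleLaw N M₁ M₂)
      (f := fun ω => ENNReal.ofReal (T ω)) (by fun_prop)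
      (ε := ENNReal.ofReal (N * (2 + t / 2))) (ENNReal.ofReal_pos.2 hpos).ne' ENNReal.ofReal_ne_top
    refine (measure_mono fun ω hω => ENNReal.ofReal_le_ofReal hω).trans (h.trans ?_)
    refine (ENNReal.div_le_div_right hE _).trans_eq ?_
    rw [← ENNReal.ofReal_div_of_pos hpos]
    congr 1
    field_simp
  -- The slack `t` is shared out as `t / 2` for the output energy and `t / 4` for each noise block.
  have hcheb := noiseLaw_energy_le N hN (ε := t / 4) (by positivity)
  have hmp₁ : MeasurePreserving (fun ω : Sample N M₁ M₂ => ω.2.1) (sampleLaw N M₁ M₂)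
      (noiseLaw N) := measurePreserving_fst.comp measurePreserving_snd
  have hmp₂ : MeasurePreserving (fun ω : Sample N M₁ M₂ => ω.2.2) (sampleLaw N M₁ M₂)
      (noiseLaw N) := measurePreserving_snd.comp measurePreserving_snd
  have hms : MeasurableSet {z : Fin N → ℂ | ∑ i, ‖z i‖ ^ 2 ≤ N * (1 - t / 4)} :=
    measurableSet_le (by fun_prop) measurable_const
  have hS₁ := (hmp₁.measure_preimage hms.nullMeasurableSet).trans_le hcheb
  have hS₂ := (hmp₂.measure_preimage hms.nullMeasurableSet).trans_le hcheb
  have hU : ∀ {A B : Set (Sample N M₁ M₂)} {x y : ENNReal}, sampleLaw N M₁ M₂ A ≤ x →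
      sampleLaw N M₁ M₂ B ≤ y → sampleLaw N M₁ M₂ (A ∪ B) ≤ x + y := fun hA hB =>
    (measure_union_le _ _).trans (add_le_add hA hB)
  rw [← hprob.measure_univ]
  refine le_trans (measure_mono ?_) (hU le_rfl (hU le_rfl
    (hU hcorrect (hU hmarkov (hU hS₁ hS₂)))))
  intro ω _
  -- A sample outside all six events would decode correctly with energy difference below `N (2 + t /
  -- 2) - 2 N (1 - t / 4) = N t`, contradicting the third event's failure.
  by_contra hω
  simp only [Set.mem_union, not_or, Set.mem_ofPred_eq, Set.mem_preimage, not_not, not_le, not_and]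
    at hω
  obtain ⟨e1, e2, e3, e4, e5, e6⟩ := hω
  have := e3 e1 e2
  simp only [hT] at e4
  nlinarith

end FeedbackCode

/-- A bound on the logarithms of the variances bounds the sum rate. -/
theorem Achievable.add_le {gd gc : ℂ} {R₁ R₂ B : ℝ} (h : Achievable gd gc R₁ R₂)
    (hB : ∀ ρ : ℝ, 0 ≤ ρ → ρ ≤ 1 →
      Real.logb 2 (condVar gd gc ρ) + Real.logb 2 (outputVar gd gc ρ) ≤ B) : R₁ + R₂ ≤ B := by
  obtain ⟨-, -, M₁, M₂, C, hM₁, hM₂, hP, he₁, he₂⟩ := h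
  by_contra! hlt
  have hlog : 0 < Real.log 2 := Real.log_pos one_lt_two
  -- Half the rate gap in nats: one `t` is spent on the typicality slack, and the other leaves the
  -- decay `exp (-(N * t))`.
  set t := Real.log 2 * (R₁ + R₂ - B) / 2 with ht
  have ht0 : 0 < t := by rw [ht]; have := sub_pos.2 hlt; positivity
  set V := Var[fun z : ℂ => ‖z‖ ^ 2; stdComplexGaussian]
  have hbound : ∀ N : ℕ, 0 < N → 1 ≤ (C N).error₁ gd gc + ((C N).error₂ gd gc +
      (ENNReal.ofReal (Real.exp (-(N * t))) + (ENNReal.ofReal (2 / (2 + t / 2)) +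
      (ENNReal.ofReal (V / (N * (t / 4) ^ 2)) + ENNReal.ofReal (V / (N * (t / 4) ^ 2)))))) := by
    intro N hN
    have p₁ : (0 : ℝ) < M₁ N := lt_of_lt_of_le (by positivity) (hM₁ N)
    have p₂ : (0 : ℝ) < M₂ N := lt_of_lt_of_le (by positivity) (hM₂ N)
    obtain ⟨ρ, h0, h1, hle⟩ := (C N).one_le_error_add gd gc (by exact_mod_cast p₁)
      (by exact_mod_cast p₂) hN (hP N) ht0
    refine hle.trans ?_
    gcongr
    have hA0 : 0 < condVar gd gc ρ := one_pos.trans_le (one_le_condVar gd gc h0 h1)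
    have hB0 : 0 < outputVar gd gc ρ := one_pos.trans_le (one_le_outputVar gd gc h0)
    have hv : condVar gd gc ρ * outputVar gd gc ρ ≤ Real.exp (Real.log 2 * B) := by
      rw [← Real.log_le_iff_le_exp (by positivity), Real.log_mul hA0.ne' hB0.ne']
      have := hB ρ h0 h1
      rw [Real.logb, Real.logb, ← add_div, div_le_iff₀ hlog] at this
      linarith
    have hM : Real.exp (N * (Real.log 2 * (R₁ + R₂))) ≤ M₁ N * M₂ N := by
      refine le_trans (le_of_eq ?_) (mul_le_mul (hM₁ N) (hM₂ N) (by positivity) p₁.le)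
      rw [← Real.rpow_add two_pos, Real.rpow_def_of_pos two_pos]
      ring_nf
    rw [div_le_iff₀ (by positivity)]
    calc (condVar gd gc ρ * outputVar gd gc ρ) ^ N * Real.exp (N * t)
        ≤ Real.exp (Real.log 2 * B) ^ N * Real.exp (N * t) := by gcongr
      _ = Real.exp (-(N * t)) * Real.exp (N * (Real.log 2 * (R₁ + R₂))) := by
        rw [← Real.exp_nat_mul, ← Real.exp_add, ← Real.exp_add, ht]
        ring_nf
      _ ≤ Real.exp (-(N * t)) * (M₁ N * M₂ N) := by gcongr
  have hN : Tendsto (fun N : ℕ => (N : ℝ)) atTop atTop := tendsto_natCast_atTop_atTop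
  have l1 : Tendsto (fun N : ℕ => ENNReal.ofReal (Real.exp (-(N * t)))) atTop (𝓝 0) := by
    rw [← ENNReal.ofReal_zero]
    exact ENNReal.tendsto_ofReal
      (Real.tendsto_exp_neg_atTop_nhds_zero.comp (hN.atTop_mul_const ht0))
  have l2 : Tendsto (fun N : ℕ => ENNReal.ofReal (V / (N * (t / 4) ^ 2))) atTop (𝓝 0) := by
    rw [← ENNReal.ofReal_zero]
    exact ENNReal.tendsto_ofReal
      (tendsto_const_nhds.div_atTop (hN.atTop_mul_const (by positivity)))
  have hlim := he₁.add (he₂.add (l1.add ((tendsto_const_nhds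
    (x := ENNReal.ofReal (2 / (2 + t / 2)))).add (l2.add l2))))
  have hle := ge_of_tendsto hlim ((eventually_gt_atTop 0).mono hbound)
  simp only [zero_add, add_zero] at hle
  -- Only the Markov term survives in the limit, and it is strictly below one.
  refine absurd hle (not_le.2 ?_)
  rw [ENNReal.ofReal_lt_one, div_lt_one (by positivity)]
  linarith

/-- A crude bound uniform in `ρ`, which makes the supremum in the theorem finite. -/
theorem logb_condVar_add_logb_outputVar_le (gd gc : ℂ) {ρ : ℝ} (h0 : 0 ≤ ρ) (h1 : ρ ≤ 1) :
    Real.logb 2 (condVar gd gc ρ) + Real.logb 2 (outputVar gd gc ρ) ≤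
      Real.logb 2 (1 + SNR gd) + Real.logb 2 (outputVar gd gc 1) := by
  have hs : 0 ≤ 1 - ρ ^ 2 := by nlinarith
  have hA := one_le_condVar gd gc h0 h1
  have hB := one_le_outputVar gd gc h0
  refine add_le_add (Real.logb_le_logb_of_le one_lt_two (by linarith) ?_)
    (Real.logb_le_logb_of_le one_lt_two (by linarith) ?_)
  · unfold condVar SNR INR
    have h2 : 1 ≤ 1 + (1 - ρ ^ 2) * ‖gc‖ ^ 2 := le_add_of_nonneg_right (by positivity)
    have h3 : (1 - ρ ^ 2) * ‖gd‖ ^ 2 / (1 + (1 - ρ ^ 2) * ‖gc‖ ^ 2) ≤ (1 - ρ ^ 2) * ‖gd‖ ^ 2 :=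
      div_le_self (by positivity) h2
    nlinarith [mul_nonneg (sq_nonneg ρ) (sq_nonneg ‖gd‖)]
  · unfold outputVar
    gcongr

end GaussianIC

theorem theorem3 (gd gc : ℂ) :
    GaussianIC.symmetricCapacity gd gc ≤
      ((1 / 2 : ℝ) : EReal) * ⨆ (ρ : ℝ) (_ : 0 ≤ ρ ∧ ρ ≤ 1),
        ((Real.logb 2 (1 + (1 - ρ ^ 2) * GaussianIC.SNR gd /
              (1 + (1 - ρ ^ 2) * GaussianIC.INR gc)) +
          Real.logb 2 (1 + GaussianIC.SNR gd + GaussianIC.INR gc +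
              2 * ρ * Real.sqrt (GaussianIC.SNR gd * GaussianIC.INR gc)) : ℝ) : EReal) := by
  change _ ≤ ((1 / 2 : ℝ) : EReal) * ⨆ (ρ : ℝ) (_ : 0 ≤ ρ ∧ ρ ≤ 1),
    ((Real.logb 2 (GaussianIC.condVar gd gc ρ) +
      Real.logb 2 (GaussianIC.outputVar gd gc ρ) : ℝ) : EReal)
  set s := ⨆ (ρ : ℝ) (_ : 0 ≤ ρ ∧ ρ ≤ 1), ((Real.logb 2 (GaussianIC.condVar gd gc ρ) +
      Real.logb 2 (GaussianIC.outputVar gd gc ρ) : ℝ) : EReal)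
  have hle : ∀ ρ : ℝ, 0 ≤ ρ → ρ ≤ 1 → ((Real.logb 2 (GaussianIC.condVar gd gc ρ) +
      Real.logb 2 (GaussianIC.outputVar gd gc ρ) : ℝ) : EReal) ≤ s := fun ρ h0 h1 =>
    le_iSup₂ (f := fun (ρ : ℝ) (_ : 0 ≤ ρ ∧ ρ ≤ 1) => ((Real.logb 2 (GaussianIC.condVar gd gc ρ) +
      Real.logb 2 (GaussianIC.outputVar gd gc ρ) : ℝ) : EReal)) ρ ⟨h0, h1⟩
  have htop : s ≠ ⊤ := by
    refine ne_top_of_le_ne_top (EReal.coe_ne_top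
      (Real.logb 2 (1 + GaussianIC.SNR gd) + Real.logb 2 (GaussianIC.outputVar gd gc 1))) ?_
    exact iSup₂_le fun ρ h => EReal.coe_le_coe_iff.2
      (GaussianIC.logb_condVar_add_logb_outputVar_le gd gc h.1 h.2)
  have hbot : s ≠ ⊥ := ne_bot_of_le_ne_bot (EReal.coe_ne_bot _) (hle 0 le_rfl zero_le_one)
  clear_value s
  lift s to ℝ using ⟨htop, hbot⟩
  -- A half-plane is closed, so the sum-rate bound survives the closure that defines the region.
  have hregion : GaussianIC.capacityRegion gd gc ⊆ {R : ℝ × ℝ | R.1 + R.2 ≤ s} :=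
    closure_minimal (fun R hR => hR.add_le fun ρ h0 h1 => EReal.coe_le_coe_iff.1 (hle ρ h0 h1))
      (isClosed_le (by fun_prop) continuous_const)
  refine iSup₂_le fun R hR => ?_
  have h : R + R ≤ s := hregion hR
  rw [← EReal.coe_mul, EReal.coe_le_coe_iff]
  linarith
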